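/- Let $A\in\mathbb R^{n\times n}$, $B\in\mathbb R^{n\times m}$, $C\in\mathbb R^{l\times n}$ have relative degree $r\ge2$, i.e. $CA^iB=0$ for $i=0,\dots,r-2$ and $CA^{r-1}B\neq0$. Let $h>0$ (sampling period), $t_k=kh$ for $k=0,1,2,\dots$, let $0<q_1<\dots<q_{r-1}$ be integers (discrete-time delays), put $q_0=0$, and let $K_0,\dots,K_{r-1}\in\mathbb R^{m\times l}$ (gains), $\sigma\in[0,1)$ (triggering threshold) and $\alpha>0$ (decay rate). Suppose that there are symmetric positive-definite matrices $P\in\mathbb R^{n\times n}$ and $\Omega,W_0,\dots,W_{r-1},R_1,\dots,R_{r-1}\in\mathbb R^{m\times m}$ such that the symmetric matrix $$\Phi_e=\begin{bmatrix} \Phi_{11}&\Phi_{12}&\Phi_{13}&\Phi_{14}&PB&\sigma F^T\Omega\\ *&\Phi_{22}&0&\Phi_{24}&0&\sigma\mathbf 1_r\otimes\Omega\\ *&*&\Phi_{33}&\Phi_{34}&0&\sigma\mathbf 1_{r-1}\otimes\Omega\\ *&*&*&\Phi_{44}&HCA^{r-1}B&0\\ *&*&*&*&-\Omega&0\\ *&*&*&*&*&-\sigma\Omega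 \end{bmatrix}$$ is negative semidefinite ($\Phi_e\le0$). Here $\mathbf 1_j=[1,\dots,1]^T\in\mathbb R^j$, $\otimes$ is the Kronecker product, $F=[K_0,K_1,\dots,K_{r-1}]M\bar C$, where $M$ is the $rl\times rl$ matrix with blocks $\frac{(-q_ih)^j}{j!}I_l$, $i,j=0,\dots,r-1$ (with $0^0=1$, so that its first block row is $[I_l,0,\dots,0]$), and $\bar C$ is the block column with blocks $C,CA,\dots,CA^{r-1}$; further $D=A+BF$, $H=\sum_{i=1}^{r-1}(q_ih)^rK_i^TR_iK_i$, and $$\begin{aligned} \Phi_{11}&=PD+D^TP+2\alpha P+h^2e^{2\alpha h}\sum_{i=0}^{r-1}(K_iCA)^TW_i(K_iCA),\\ \Phi_{12}&=\mathbf 1_r^T\otimes PB,\qquad \Phi_{13}=\mathbf 1_{r-1}^T\otimes PB,\qquad \Phi_{14}=(CA^{r-1}D)^TH,\\ \Phi_{22}&=-\tfrac{\pi^2}{4}\operatorname{diag}\{W_0,e^{-2\alpha q_1h}W_1,\dots,e^{-2\alpha q_{r-1}h}W_{r-1}\},\qquad \Phi_{24}=\mathbf 1_r\otimes(CA^{r-1}B)^TH,\\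 \Phi_{33}&=-(r!)^2\operatorname{diag}\Bigl\{\tfrac{e^{-2\alpha q_1h}}{(q_1h)^r}R_1,\dots,\tfrac{e^{-2\alpha q_{r-1}h}}{(q_{r-1}h)^r}R_{r-1}\Bigr\},\qquad \Phi_{34}=\mathbf 1_{r-1}\otimes(CA^{r-1}B)^TH,\qquad \Phi_{44}=-H. \end{aligned}$$ Consider the closed loop $$\dot x(t)=Ax(t)+B\hat u_k,\quad t\in[t_k,t_{k+1}),\qquad y(t)=Cx(t)\ (t\ge0),\quad y(t)=0\ (t<0),\qquad u(t_k)=K_0y(t_k)+\sum_{i=1}^{r-1}K_iy(t_k-q_ih),$$ where $x$ is continuous on $[0,\infty)$, $\hat u_0=u(t_0)$ and, for $k\ge1$, $\hat u_k=u(t_k)$ if $$(u(t_k)-\hat u_{k-1})^T\Omega(u(t_k)-\hat u_{k-1})>\sigma u(t_k)^T\Omega u(t_k),$$ and $\hat u_k=\hat u_{k-1}$ otherwise. Then this event-triggered controller exponentially stabilizes the system with decay rate $\alpha$: there is a constant $c>0$ such that for every initial state $x(0)\in\mathbb R^n$ the closed loop has a solution on $[0,\infty)$, and every solution satisfies $|x(t)|\le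 c\,e^{-\alpha t}|x(0)|$ for all $t\ge0$. -/

import Mathlib

open scoped Matrix

noncomputable section

namespace EventTriggered

/-! Throughout, `s = r - 1 ≥ 1` is the number of delayed samples used by the controller, where
`r = s + 1` is the relative degree.  The gains are `K 0, …, K s`, and `q i` (`i : Fin s`) is the
`(i+1)`-st discrete-time delay, so that the gain that goes with it is `K i.succ`. -/

/-- `ẋ = A x + B u`, `y = C x` has relative degree `r`:
`C A ^ i B = 0` for `i = 0, …, r - 2` and `C A ^ (r - 1) B ≠ 0`. -/
def HasRelativeDegree {n m l : ℕ} (A : Matrix (Fin n) (Fin n) ℝ) (B : Matrix (Fin n) (Fin m) ℝ)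
    (C : Matrix (Fin l) (Fin n) ℝ) (r : ℕ) : Prop :=
  (∀ i : ℕ, i + 2 ≤ r → C * A ^ i * B = 0) ∧ C * A ^ (r - 1) * B ≠ 0

/-! ### The closed loop -/

/-- The output `y(t) = C x(t)`, with the convention `y(t) = 0` for `t < 0`. -/
def output {n l : ℕ} (C : Matrix (Fin l) (Fin n) ℝ) (x : ℝ → Fin n → ℝ) (t : ℝ) : Fin l → ℝ :=
  if t < 0 then 0 else C *ᵥ x t

/-- The control signal `u(t_k) = K₀ y(t_k) + ∑ᵢ Kᵢ y(t_k - qᵢ h)` at `t_k = k h`. -/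
def control {n m l s : ℕ} (C : Matrix (Fin l) (Fin n) ℝ)
    (K : Fin (s + 1) → Matrix (Fin m) (Fin l) ℝ) (q : Fin s → ℕ) (h : ℝ)
    (x : ℝ → Fin n → ℝ) (k : ℕ) : Fin m → ℝ :=
  K 0 *ᵥ output C x (k * h) + ∑ i : Fin s, K i.succ *ᵥ output C x (k * h - q i * h)

/-- The event-triggering rule: given that `û` is the signal transmitted last, the signal `u` is
transmitted if and only if `(u - û)ᵀ Ω (u - û) > σ uᵀ Ω u`. -/
def Triggered {m : ℕ} (Ω : Matrix (Fin m) (Fin m) ℝ) (σ : ℝ) (u û : Fin m → ℝ) : Prop :=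
  (u - û) ⬝ᵥ (Ω *ᵥ (u - û)) > σ * (u ⬝ᵥ (Ω *ᵥ u))

/-- `x` (on `[0, ∞)`) and the applied control values `û 0, û 1, …` solve the closed loop:
`x` is continuous, `ẋ(t) = A x(t) + B û_k` on `[t_k, t_{k+1})` (a right derivative at `t_k`,
a two-sided one inside), `û_0 = u(t_0)`, and `û_{k+1}` is `u(t_{k+1})` or `û_k` according to
the event-triggering rule. -/
structure IsTrajectory {n m l s : ℕ} (A : Matrix (Fin n) (Fin n) ℝ)
    (B : Matrix (Fin n) (Fin m) ℝ) (C : Matrix (Fin l) (Fin n) ℝ)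
    (K : Fin (s + 1) → Matrix (Fin m) (Fin l) ℝ) (q : Fin s → ℕ) (h : ℝ)
    (Ω : Matrix (Fin m) (Fin m) ℝ) (σ : ℝ)
    (x : ℝ → Fin n → ℝ) (û : ℕ → Fin m → ℝ) : Prop where
  continuousOn : ContinuousOn x (Set.Ici 0)
  hasDeriv : ∀ k : ℕ, ∀ t ∈ Set.Ico ((k : ℝ) * h) (((k : ℝ) + 1) * h),
    HasDerivWithinAt x (A *ᵥ x t + B *ᵥ û k) (Set.Ici ((k : ℝ) * h)) t
  init : û 0 = control C K q h x 0
  transmit : ∀ k : ℕ, Triggered Ω σ (control C K q h x (k + 1)) (û k) →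
    û (k + 1) = control C K q h x (k + 1)
  hold : ∀ k : ℕ, ¬ Triggered Ω σ (control C K q h x (k + 1)) (û k) → û (k + 1) = û k

/-- The Euclidean norm of a vector. -/
def euclNorm {n : ℕ} (v : Fin n → ℝ) : ℝ := ‖(WithLp.toLp 2 v : EuclideanSpace ℝ (Fin n))‖

/-- The event-triggered controller exponentially stabilizes the system with decay rate `α`:
there is a constant `c`, independent of the initial state, such that from each initial state
the closed loop has a solution on `[0, ∞)`, and every such solution satisfies
`|x(t)| ≤ c e^{-α t} |x(0)|` for all `t ≥ 0`. -/
def ExponentiallyStabilizes {n m l s : ℕ} (A : Matrix (Fin n) (Fin n) ℝ)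
    (B : Matrix (Fin n) (Fin m) ℝ) (C : Matrix (Fin l) (Fin n) ℝ)
    (K : Fin (s + 1) → Matrix (Fin m) (Fin l) ℝ) (q : Fin s → ℕ) (h : ℝ)
    (Ω : Matrix (Fin m) (Fin m) ℝ) (σ α : ℝ) : Prop :=
  ∃ c : ℝ, 0 < c ∧ ∀ x₀ : Fin n → ℝ,
    (∃ (x : ℝ → Fin n → ℝ) (û : ℕ → Fin m → ℝ),
      IsTrajectory A B C K q h Ω σ x û ∧ x 0 = x₀) ∧
    ∀ (x : ℝ → Fin n → ℝ) (û : ℕ → Fin m → ℝ),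
      IsTrajectory A B C K q h Ω σ x û → x 0 = x₀ →
      ∀ t : ℝ, 0 ≤ t → euclNorm (x t) ≤ c * Real.exp (-α * t) * euclNorm x₀

/-! ### The matrices of the LMI

A block vector with blocks `v i` (`i : ι`) of length `m` has the index type `ι × Fin m`. -/

/-- `1 ⊗ X`: the block column all of whose blocks, indexed by `ι`, are `X`. -/
def repCol (ι : Type) {a b : Type} (X : Matrix a b ℝ) : Matrix (ι × a) b ℝ :=
  Matrix.of fun p j => X p.2 j

/-- `1ᵀ ⊗ X`: the block row all of whose blocks, indexed by `ι`, are `X`. -/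
def repRow (ι : Type) {a b : Type} (X : Matrix a b ℝ) : Matrix a (ι × b) ℝ :=
  Matrix.of fun i p => X i p.2

/-- `diag {X i}`, the block diagonal matrix with diagonal blocks `X i`. -/
def blockDiag {ι a : Type} [DecidableEq ι] (X : ι → Matrix a a ℝ) : Matrix (ι × a) (ι × a) ℝ :=
  Matrix.of fun p p' => if p.1 = p'.1 then X p.1 p.2 p'.2 else 0

/-- The delays `q₀ = 0, q₁, …, q_{r-1}`. -/
def delay {s : ℕ} (q : Fin s → ℕ) : Fin (s + 1) → ℕ := Fin.cons 0 q

/-- The matrix `M` with blocks `((-qᵢ h)ʲ / j!) I_l` for `i, j = 0, …, r - 1`, where `q₀ = 0`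
(so its block row number `0` is `[I_l, 0, …, 0]`). -/
def matM {s : ℕ} (l : ℕ) (q : Fin s → ℕ) (h : ℝ) :
    Matrix (Fin (s + 1) × Fin l) (Fin (s + 1) × Fin l) ℝ :=
  Matrix.of fun p p' =>
    if p.2 = p'.2 then (-(delay q p.1 * h)) ^ (p'.1 : ℕ) / ((p'.1 : ℕ).factorial : ℝ) else 0

/-- The block row `[K₀, K₁, …, K_{r-1}]`. -/
def matK {m l s : ℕ} (K : Fin (s + 1) → Matrix (Fin m) (Fin l) ℝ) :
    Matrix (Fin m) (Fin (s + 1) × Fin l) ℝ :=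
  Matrix.of fun a p => K p.1 a p.2

/-- The block column `col {C, C A, …, C A ^ (r - 1)}`. -/
def matCbar {n l : ℕ} (s : ℕ) (A : Matrix (Fin n) (Fin n) ℝ) (C : Matrix (Fin l) (Fin n) ℝ) :
    Matrix (Fin (s + 1) × Fin l) (Fin n) ℝ :=
  Matrix.of fun p j => (C * A ^ (p.1 : ℕ)) p.2 j

/-- `[K₀, …, K_{r-1}] M C̄`. -/
def matF {n m l s : ℕ} (A : Matrix (Fin n) (Fin n) ℝ) (C : Matrix (Fin l) (Fin n) ℝ)
    (K : Fin (s + 1) → Matrix (Fin m) (Fin l) ℝ) (q : Fin s → ℕ) (h : ℝ) :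
    Matrix (Fin m) (Fin n) ℝ :=
  matK K * matM l q h * matCbar s A C

/-- `D = A + B [K₀, …, K_{r-1}] M C̄`. -/
def matD {n m l s : ℕ} (A : Matrix (Fin n) (Fin n) ℝ) (B : Matrix (Fin n) (Fin m) ℝ)
    (C : Matrix (Fin l) (Fin n) ℝ) (K : Fin (s + 1) → Matrix (Fin m) (Fin l) ℝ)
    (q : Fin s → ℕ) (h : ℝ) : Matrix (Fin n) (Fin n) ℝ :=
  A + B * matF A C K q h

/-- `H = ∑_{i=1}^{r-1} (qᵢ h) ^ r Kᵢᵀ Rᵢ Kᵢ`. -/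
def matH {m l s : ℕ} (K : Fin (s + 1) → Matrix (Fin m) (Fin l) ℝ) (q : Fin s → ℕ) (h : ℝ)
    (R : Fin s → Matrix (Fin m) (Fin m) ℝ) : Matrix (Fin l) (Fin l) ℝ :=
  ∑ i : Fin s, ((q i : ℝ) * h) ^ (s + 1) • ((K i.succ)ᵀ * R i * K i.succ)

/-- The index type of `Φ`: four block rows, of heights `n`, `r m`, `(r - 1) m` and `l`. -/
abbrev PhiIndex (n m l s : ℕ) : Type :=
  (Fin n ⊕ (Fin (s + 1) × Fin m)) ⊕ ((Fin s × Fin m) ⊕ Fin l)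

/-- `Φ₁₁ = P D + Dᵀ P + 2 α P + h² e^{2αh} ∑_{i=0}^{r-1} (Kᵢ C A)ᵀ Wᵢ (Kᵢ C A)`. -/
def phi11 {n m l s : ℕ} (A : Matrix (Fin n) (Fin n) ℝ) (B : Matrix (Fin n) (Fin m) ℝ)
    (C : Matrix (Fin l) (Fin n) ℝ) (K : Fin (s + 1) → Matrix (Fin m) (Fin l) ℝ)
    (q : Fin s → ℕ) (h α : ℝ) (P : Matrix (Fin n) (Fin n) ℝ)
    (W : Fin (s + 1) → Matrix (Fin m) (Fin m) ℝ) : Matrix (Fin n) (Fin n) ℝ :=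
  P * matD A B C K q h + (matD A B C K q h)ᵀ * P + (2 * α) • P +
    (h ^ 2 * Real.exp (2 * α * h)) •
      ∑ i : Fin (s + 1), (K i * C * A)ᵀ * W i * (K i * C * A)

/-- `Φ₂₂ = -(π²/4) diag {W₀, e^{-2αq₁h} W₁, …, e^{-2αq_{r-1}h} W_{r-1}}`. -/
def phi22 {m s : ℕ} (q : Fin s → ℕ) (h α : ℝ) (W : Fin (s + 1) → Matrix (Fin m) (Fin m) ℝ) :
    Matrix (Fin (s + 1) × Fin m) (Fin (s + 1) × Fin m) ℝ :=
  -((Real.pi ^ 2 / 4) •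
    blockDiag fun i : Fin (s + 1) => Real.exp (-2 * α * (delay q i * h)) • W i)

/-- `Φ₃₃ = -(r!)² diag {e^{-2αqᵢh} / (qᵢh)^r Rᵢ}_{i=1,…,r-1}`. -/
def phi33 {m s : ℕ} (q : Fin s → ℕ) (h α : ℝ) (R : Fin s → Matrix (Fin m) (Fin m) ℝ) :
    Matrix (Fin s × Fin m) (Fin s × Fin m) ℝ :=
  -(((s + 1).factorial : ℝ) ^ 2 •
    blockDiag fun i : Fin s =>
      (Real.exp (-2 * α * (q i * h)) / ((q i : ℝ) * h) ^ (s + 1)) • R i)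

/-- The symmetric matrix `Φ = (Φ_{ij})`, `i, j = 1, …, 4`, where `Φ₁₂ = 1_rᵀ ⊗ P B`,
`Φ₁₃ = 1_{r-1}ᵀ ⊗ P B`, `Φ₁₄ = (C A^{r-1} D)ᵀ H`, `Φ₂₃ = 0`, `Φ₂₄ = 1_r ⊗ (C A^{r-1} B)ᵀ H`,
`Φ₃₄ = 1_{r-1} ⊗ (C A^{r-1} B)ᵀ H`, `Φ₄₄ = -H`. -/
def phi {n m l s : ℕ} (A : Matrix (Fin n) (Fin n) ℝ) (B : Matrix (Fin n) (Fin m) ℝ)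
    (C : Matrix (Fin l) (Fin n) ℝ) (K : Fin (s + 1) → Matrix (Fin m) (Fin l) ℝ)
    (q : Fin s → ℕ) (h α : ℝ) (P : Matrix (Fin n) (Fin n) ℝ)
    (W : Fin (s + 1) → Matrix (Fin m) (Fin m) ℝ) (R : Fin s → Matrix (Fin m) (Fin m) ℝ) :
    Matrix (PhiIndex n m l s) (PhiIndex n m l s) ℝ :=
  let H := matH K q h R
  let phi12 := repRow (Fin (s + 1)) (P * B)
  let phi13 := repRow (Fin s) (P * B)
  let phi14 := (C * A ^ s * matD A B C K q h)ᵀ * H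
  let phi24 := repCol (Fin (s + 1)) ((C * A ^ s * B)ᵀ * H)
  let phi34 := repCol (Fin s) ((C * A ^ s * B)ᵀ * H)
  let upperRight := Matrix.fromBlocks phi13 phi14 0 phi24
  Matrix.fromBlocks
    (Matrix.fromBlocks (phi11 A B C K q h α P W) phi12 phi12ᵀ (phi22 q h α W))
    upperRight upperRightᵀ
    (Matrix.fromBlocks (phi33 q h α R) phi34 phi34ᵀ (-H))

/-- The symmetric matrix `Φ_e`: `Φ` bordered by the two block columns
`[P B; 0; 0; H C A^{r-1} B]` and `[σ ([K₀, …, K_{r-1}] M C̄)ᵀ Ω; σ 1_r ⊗ Ω; σ 1_{r-1} ⊗ Ω; 0]`,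
with the lower right corner `diag {-Ω, -σ Ω}`. -/
def phiE {n m l s : ℕ} (A : Matrix (Fin n) (Fin n) ℝ) (B : Matrix (Fin n) (Fin m) ℝ)
    (C : Matrix (Fin l) (Fin n) ℝ) (K : Fin (s + 1) → Matrix (Fin m) (Fin l) ℝ)
    (q : Fin s → ℕ) (h α σ : ℝ) (P : Matrix (Fin n) (Fin n) ℝ)
    (Ω : Matrix (Fin m) (Fin m) ℝ)
    (W : Fin (s + 1) → Matrix (Fin m) (Fin m) ℝ) (R : Fin s → Matrix (Fin m) (Fin m) ℝ) :
    Matrix (PhiIndex n m l s ⊕ (Fin m ⊕ Fin m)) (PhiIndex n m l s ⊕ (Fin m ⊕ Fin m)) ℝ :=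
  let border : Matrix (PhiIndex n m l s) (Fin m ⊕ Fin m) ℝ :=
    Matrix.fromRows
      (Matrix.fromBlocks
        (P * B) (σ • ((matF A C K q h)ᵀ * Ω))
        0       (σ • repCol (Fin (s + 1)) Ω))
      (Matrix.fromBlocks
        0                                (σ • repCol (Fin s) Ω)
        (matH K q h R * (C * A ^ s * B)) 0)
  Matrix.fromBlocks (phi A B C K q h α P W R) border borderᵀ
    (Matrix.fromBlocks (-Ω) 0 0 (-(σ • Ω)))

end EventTriggered

end

/-! The proof is a Lyapunov argument in integrated form. From the sampling instant `t₀ = N h`, `N =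
∑ qᵢ`, on, every delayed time is nonnegative, and the control splits exactly as `u = F x + ∑ δᵢ + ∑
κᵢ`. Here `δᵢ` is the error of replacing `t` by the last sampling instant in `Kᵢ y(t - qᵢ h)`, and
`κᵢ` is the remainder of the Taylor expansion of `Kᵢ y(t - qᵢ h)` at `t`. The relative degree makes
`C Aʲ x` the `j`-th derivative of `y` for `j < r`, so `F x` collects the Taylor polynomials
(`control_eq_sum_errors`).

The LMI, evaluated at the signals of the closed loop, bounds the derivative of `e^{2αt} xᵀ P x` by
weighted energies of `δᵢ` and `κᵢ`, minus energies of `Kᵢ C A x` and `Kᵢ y^{(r)}`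
(`lmi_dissipation`). The triggering rule supplies `êᵀ Ω ê ≤ σ uᵀ Ω u` for the transmission error,
which cancels the remaining terms.

After integration over `[t₀, T]`, Wirtinger's inequality bounds the energy of `δᵢ` by that of `Kᵢ C
A x` (`sampling_error_energy`), and Cauchy–Schwarz with Fubini bounds the energy of `κᵢ` by that of
`Kᵢ y^{(r)}` (`taylor_error_energy`). The constants are those of the LMI, so everything cancels
except integrals over `[t₀ - qᵢ h, t₀]`, caused by the delays. Hence `e^{2αT} x(T)ᵀ P x(T)` is at
most an energy of the initial interval (`IsTrajectory.lyapunov_le`), and Grönwall's inequality makes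
that energy `O(|x(0)|²)`. Existence follows by solving from one sampling instant to the next. -/

namespace EventTriggered

/-! ### Quadratic forms of block matrices and the LMI. -/

variable {n m l s : ℕ}

/-- The quadratic form `zᵀ X z`. -/
def quadForm {a : Type*} [Fintype a] (X : Matrix a a ℝ) (z : a → ℝ) : ℝ := z ⬝ᵥ (X *ᵥ z)

theorem repCol_mulVec {ι a b : Type} [Fintype b] (X : Matrix a b ℝ) (v : b → ℝ) :
    repCol ι X *ᵥ v = fun p => (X *ᵥ v) p.2 := rfl

theorem repRow_mulVec {ι a b : Type} [Fintype ι] [Fintype b] (X : Matrix a b ℝ) (w : ι → b → ℝ) :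
    repRow ι X *ᵥ (fun p : ι × b => w p.1 p.2) = X *ᵥ (∑ i, w i) := by
  ext i
  simp only [repRow, Matrix.mulVec, dotProduct, Matrix.of_apply, Fintype.sum_prod_type,
    Finset.sum_apply, Finset.mul_sum]
  exact Finset.sum_comm

theorem blockDiag_mulVec {ι a : Type} [Fintype ι] [Fintype a] [DecidableEq ι] (X : ι → Matrix a a ℝ) (w : ι → a → ℝ) :
    blockDiag X *ᵥ (fun p : ι × a => w p.1 p.2) = fun p => (X p.1 *ᵥ w p.1) p.2 := by
  ext p
  simp only [blockDiag, Matrix.mulVec, dotProduct, Matrix.of_apply, Fintype.sum_prod_type,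
    ite_mul, zero_mul]
  rw [Finset.sum_eq_single p.1]
  · simp
  · intro i _ hi
    simp [hi.symm]
  · simp

theorem stack_dotProduct {ι a : Type} [Fintype ι] [Fintype a] (w : ι → a → ℝ) (v : ι → a → ℝ) :
    (fun p : ι × a => w p.1 p.2) ⬝ᵥ (fun p : ι × a => v p.1 p.2) = ∑ i, w i ⬝ᵥ v i := by
  simp only [dotProduct, Fintype.sum_prod_type]

theorem stack_dotProduct_const {ι a : Type} [Fintype ι] [Fintype a] (w : ι → a → ℝ) (v : a → ℝ) :
    (fun p : ι × a => w p.1 p.2) ⬝ᵥ (fun p : ι × a => v p.2) = (∑ i, w i) ⬝ᵥ v := by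
  rw [stack_dotProduct w (fun _ => v), sum_dotProduct]

theorem quadForm_sum {ι a : Type*} [Fintype ι] [Fintype a] (X : ι → Matrix a a ℝ) (z : a → ℝ) :
    quadForm (∑ i, X i) z = ∑ i, quadForm (X i) z := by
  simp [quadForm, Matrix.sum_mulVec, dotProduct_sum]

theorem quadForm_smul {a : Type*} [Fintype a] (c : ℝ) (X : Matrix a a ℝ) (z : a → ℝ) :
    quadForm (c • X) z = c * quadForm X z := by
  simp [quadForm, Matrix.smul_mulVec, dotProduct_smul]

theorem dotProduct_transpose_mulVec {a b : Type*} [Fintype a] [Fintype b] (Y : Matrix b a ℝ)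
    (x : a → ℝ) (z : b → ℝ) : x ⬝ᵥ (Yᵀ *ᵥ z) = (Y *ᵥ x) ⬝ᵥ z := by
  rw [Matrix.mulVec_transpose, dotProduct_comm, ← Matrix.dotProduct_mulVec, dotProduct_comm]

theorem quadForm_congr {a b : Type*} [Fintype a] [Fintype b] (X : Matrix b b ℝ)
    (Y : Matrix b a ℝ) (z : a → ℝ) : quadForm (Yᵀ * X * Y) z = quadForm X (Y *ᵥ z) := by
  simp only [quadForm]
  rw [← Matrix.mulVec_mulVec, ← Matrix.mulVec_mulVec, dotProduct_transpose_mulVec]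

theorem dotProduct_mulVec_symm {a : Type*} [Fintype a] {X : Matrix a a ℝ} (hX : Xᵀ = X)
    (x z : a → ℝ) : x ⬝ᵥ (X *ᵥ z) = z ⬝ᵥ (X *ᵥ x) := by
  rw [← hX, dotProduct_transpose_mulVec, dotProduct_comm, hX]

theorem matH_transpose (K : Fin (s + 1) → Matrix (Fin m) (Fin l) ℝ) (q : Fin s → ℕ) (h : ℝ)
    {R : Fin s → Matrix (Fin m) (Fin m) ℝ} (hR : ∀ i, (R i)ᵀ = R i) :
    (matH K q h R)ᵀ = matH K q h R := by
  simp [matH, Matrix.transpose_sum, Matrix.transpose_mul, hR, Matrix.mul_assoc]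

theorem quadForm_matH (K : Fin (s + 1) → Matrix (Fin m) (Fin l) ℝ) (q : Fin s → ℕ) (h : ℝ)
    (R : Fin s → Matrix (Fin m) (Fin m) ℝ) (z : Fin l → ℝ) :
    quadForm (matH K q h R) z =
      ∑ i : Fin s, ((q i : ℝ) * h) ^ (s + 1) * quadForm (R i) (K i.succ *ᵥ z) := by
  simp only [matH, quadForm_sum, quadForm_smul, quadForm_congr]

theorem quadForm_phi11 (A : Matrix (Fin n) (Fin n) ℝ) (B : Matrix (Fin n) (Fin m) ℝ)
    (C : Matrix (Fin l) (Fin n) ℝ) (K : Fin (s + 1) → Matrix (Fin m) (Fin l) ℝ)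
    (q : Fin s → ℕ) (h α : ℝ) {P : Matrix (Fin n) (Fin n) ℝ} (hP : Pᵀ = P)
    (W : Fin (s + 1) → Matrix (Fin m) (Fin m) ℝ) (x : Fin n → ℝ) :
    quadForm (phi11 A B C K q h α P W) x =
      2 * (x ⬝ᵥ (P *ᵥ (matD A B C K q h *ᵥ x))) + 2 * α * quadForm P x
        + h ^ 2 * Real.exp (2 * α * h) *
          ∑ i, quadForm (W i) (K i *ᵥ (C *ᵥ (A *ᵥ x))) := by
  have hD : x ⬝ᵥ (((matD A B C K q h)ᵀ * P) *ᵥ x) =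
      x ⬝ᵥ (P *ᵥ (matD A B C K q h *ᵥ x)) := by
    rw [← Matrix.mulVec_mulVec, dotProduct_transpose_mulVec, dotProduct_mulVec_symm hP]
  have hW : x ⬝ᵥ ((∑ i : Fin (s + 1), (K i * C * A)ᵀ * W i * (K i * C * A)) *ᵥ x) =
      ∑ i, quadForm (W i) (K i *ᵥ (C *ᵥ (A *ᵥ x))) := by
    have := quadForm_sum (fun i : Fin (s + 1) => (K i * C * A)ᵀ * W i * (K i * C * A)) x
    rw [quadForm] at this
    rw [this]
    simp only [quadForm_congr, ← Matrix.mulVec_mulVec]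
  simp only [phi11, quadForm, Matrix.add_mulVec, dotProduct_add, Matrix.smul_mulVec,
    dotProduct_smul, smul_eq_mul]
  rw [hD, hW, ← Matrix.mulVec_mulVec]
  simp only [quadForm]
  ring

theorem quadForm_sum_elim {a b : Type*} [Fintype a] [Fintype b] (X : Matrix a a ℝ)
    (Y : Matrix a b ℝ) (Z : Matrix b b ℝ) (v : a → ℝ) (w : b → ℝ) :
    quadForm (Matrix.fromBlocks X Y Yᵀ Z) (Sum.elim v w) =
      quadForm X v + 2 * (v ⬝ᵥ (Y *ᵥ w)) + quadForm Z w := by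
  simp only [quadForm, Matrix.fromBlocks_mulVec, Sum.elim_comp_inl, Sum.elim_comp_inr,
    sumElim_dotProduct_sumElim, dotProduct_add, dotProduct_transpose_mulVec]
  rw [dotProduct_comm (Y *ᵥ w) v]
  ring

/-- The LMI evaluated at the vector of all signals of the closed loop. -/
theorem lmi_dissipation (A : Matrix (Fin n) (Fin n) ℝ) (B : Matrix (Fin n) (Fin m) ℝ)
    (C : Matrix (Fin l) (Fin n) ℝ) (h : ℝ) (q : Fin s → ℕ)
    (K : Fin (s + 1) → Matrix (Fin m) (Fin l) ℝ) (σ α : ℝ)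
    {P : Matrix (Fin n) (Fin n) ℝ} (hP : Pᵀ = P) {Ω : Matrix (Fin m) (Fin m) ℝ}
    (W : Fin (s + 1) → Matrix (Fin m) (Fin m) ℝ)
    {R : Fin s → Matrix (Fin m) (Fin m) ℝ} (hR : ∀ i, (R i)ᵀ = R i)
    (hLMI : (-(phiE A B C K q h α σ P Ω W R)).PosSemidef)
    (x : Fin n → ℝ) (δ : Fin (s + 1) → Fin m → ℝ) (κ : Fin s → Fin m → ℝ) (e u : Fin m → ℝ)
    (hu : u = matF A C K q h *ᵥ x + ∑ i, δ i + ∑ i, κ i) (v : Fin n → ℝ)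
    (hv : v = A *ᵥ x + B *ᵥ (u + e)) :
    2 * (x ⬝ᵥ (P *ᵥ v)) + 2 * α * quadForm P x
      + h ^ 2 * Real.exp (2 * α * h) * ∑ i, quadForm (W i) (K i *ᵥ (C *ᵥ (A *ᵥ x)))
      + ∑ i : Fin s, ((q i : ℝ) * h) ^ (s + 1) *
          quadForm (R i) (K i.succ *ᵥ ((C * A ^ s) *ᵥ v))
      + σ * quadForm Ω u - quadForm Ω e
    ≤ Real.pi ^ 2 / 4 * ∑ i, Real.exp (-2 * α * (delay q i * h)) * quadForm (W i) (δ i)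
      + ((s + 1).factorial : ℝ) ^ 2 * ∑ i : Fin s,
          Real.exp (-2 * α * (q i * h)) / ((q i : ℝ) * h) ^ (s + 1) * quadForm (R i) (κ i) := by
  set H := matH K q h R with hHdef
  have hH : Hᵀ = H := matH_transpose K q h hR
  set F := matF A C K q h with hF
  set D := matD A B C K q h with hD
  set η := (C * A ^ s) *ᵥ v with hη
  have hvD : v = D *ᵥ x + B *ᵥ (∑ i, δ i) + B *ᵥ (∑ i, κ i) + B *ᵥ e := by
    rw [hv, hu, hD, matD, ← hF]
    simp only [Matrix.mulVec_add, Matrix.add_mulVec, Matrix.mulVec_mulVec]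
    abel
  -- The blocks `η` and `u` play the role of Schur complements: the cross terms with `η` add up to
  -- `2 ηᵀ H η` and those with `u` to `2 σ uᵀ Ω u`, so the diagonal blocks `-H` and `-σ Ω` leave
  -- exactly `ηᵀ H η` and `σ uᵀ Ω u`.
  have key := hLMI.dotProduct_mulVec_nonneg (Sum.elim
    (Sum.elim (Sum.elim x fun p => δ p.1 p.2) (Sum.elim (fun p => κ p.1 p.2) η))
    (Sum.elim e u))
  simp only [star_trivial, Matrix.neg_mulVec, dotProduct_neg] at key
  change 0 ≤ -quadForm (phiE A B C K q h α σ P Ω W R) _ at key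
  rw [phiE, quadForm_sum_elim, phi, quadForm_sum_elim, quadForm_sum_elim, quadForm_sum_elim,
    quadForm_phi11 _ _ _ _ _ _ _ hP] at key
  have h22 : quadForm (phi22 q h α W) (fun p => δ p.1 p.2) =
      -(Real.pi ^ 2 / 4 * ∑ i, Real.exp (-2 * α * (delay q i * h)) * quadForm (W i) (δ i)) := by
    simp only [phi22, quadForm, Matrix.neg_mulVec, Matrix.smul_mulVec (Real.pi ^ 2 / 4), blockDiag_mulVec, 
      dotProduct_neg, dotProduct_smul, smul_eq_mul]
    rw [stack_dotProduct δ (fun i => (Real.exp (-2 * α * (delay q i * h)) • W i) *ᵥ δ i)]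
    simp only [Matrix.smul_mulVec, dotProduct_smul, smul_eq_mul]
  have h33 : quadForm (phi33 q h α R) (fun p => κ p.1 p.2) =
      -(((s + 1).factorial : ℝ) ^ 2 * ∑ i : Fin s,
          Real.exp (-2 * α * (q i * h)) / ((q i : ℝ) * h) ^ (s + 1) * quadForm (R i) (κ i)) := by
    simp only [phi33, quadForm, Matrix.neg_mulVec, Matrix.smul_mulVec (_ ^ 2 : ℝ), blockDiag_mulVec, 
      dotProduct_neg, dotProduct_smul, smul_eq_mul]
    rw [stack_dotProduct κ (fun i =>
      ((Real.exp (-2 * α * (q i * h)) / ((q i : ℝ) * h) ^ (s + 1)) • R i) *ᵥ κ i)]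
    simp only [Matrix.smul_mulVec, dotProduct_smul, smul_eq_mul]
  have hee : quadForm (Matrix.fromBlocks (-Ω) 0 0 (-(σ • Ω))) (Sum.elim e u) =
      -quadForm Ω e - σ * quadForm Ω u := by
    simp [quadForm, Matrix.fromBlocks_mulVec, Matrix.neg_mulVec, Matrix.smul_mulVec]
    ring
  have hη' : quadForm (-H) η = - quadForm H η := by
    simp [quadForm, Matrix.neg_mulVec]
  rw [h22, h33, hee, ← hHdef, hη'] at key
  simp only [Matrix.fromRows_mulVec, Matrix.fromBlocks_mulVec, Sum.elim_comp_inl,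
    Sum.elim_comp_inr, sumElim_dotProduct_sumElim, Matrix.zero_mulVec, zero_add, add_zero,
    repRow_mulVec, repCol_mulVec, Matrix.smul_mulVec, dotProduct_add, stack_dotProduct_const,
    dotProduct_smul, smul_eq_mul, ← Matrix.mulVec_mulVec, dotProduct_transpose_mulVec,] at key
  have hPv : x ⬝ᵥ (P *ᵥ v) = x ⬝ᵥ (P *ᵥ (D *ᵥ x)) + x ⬝ᵥ (P *ᵥ (B *ᵥ ∑ i, δ i))
      + x ⬝ᵥ (P *ᵥ (B *ᵥ ∑ i, κ i)) + x ⬝ᵥ (P *ᵥ (B *ᵥ e)) := by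
    rw [hvD]
    simp only [Matrix.mulVec_add, dotProduct_add]
  have hΩu : quadForm Ω u = (F *ᵥ x) ⬝ᵥ (Ω *ᵥ u) + (∑ i, δ i) ⬝ᵥ (Ω *ᵥ u)
      + (∑ i, κ i) ⬝ᵥ (Ω *ᵥ u) := by
    rw [quadForm, ← add_dotProduct, ← add_dotProduct, ← hu]
  have hHη : quadForm H η = (C *ᵥ (A ^ s *ᵥ (D *ᵥ x))) ⬝ᵥ (H *ᵥ η)
      + (C *ᵥ (A ^ s *ᵥ (B *ᵥ ∑ i, δ i))) ⬝ᵥ (H *ᵥ η)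
      + (C *ᵥ (A ^ s *ᵥ (B *ᵥ ∑ i, κ i))) ⬝ᵥ (H *ᵥ η)
      + (C *ᵥ (A ^ s *ᵥ (B *ᵥ e))) ⬝ᵥ (H *ᵥ η) := by
    rw [quadForm, ← add_dotProduct, ← add_dotProduct, ← add_dotProduct]
    congr 1
    rw [hη, hvD]
    simp only [Matrix.mulVec_add, Matrix.mulVec_mulVec, Matrix.mul_assoc]
  have hsymm := dotProduct_mulVec_symm hH η (C *ᵥ (A ^ s *ᵥ (B *ᵥ e)))
  rw [← quadForm_matH, ← hHdef, hPv]
  rw [← hD, ← hF, hsymm] at key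
  linear_combination key + σ * 2 * hΩu + 2 * hHη

/-! ### A class of integrable signals closed under algebra; the applied control jumps at sampling
instants, so continuity is not enough. -/

open MeasureTheory Set

/-- Measurable functions that are bounded on every compact interval. -/
def LocBdd (f : ℝ → ℝ) : Prop :=
  Measurable f ∧ ∀ a b : ℝ, ∃ M : ℝ, ∀ t ∈ Icc a b, |f t| ≤ M

namespace LocBdd

variable {f g : ℝ → ℝ}

theorem of_continuous (hf : Continuous f) : LocBdd f := by
  refine ⟨hf.measurable, fun a b => ?_⟩
  obtain ⟨M, hM⟩ := isCompact_Icc.exists_bound_of_continuousOn (hf.continuousOn (s := Icc a b))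
  exact ⟨M, hM⟩

theorem add (hf : LocBdd f) (hg : LocBdd g) : LocBdd fun t => f t + g t := by
  refine ⟨hf.1.add hg.1, fun a b => ?_⟩
  obtain ⟨M, hM⟩ := hf.2 a b
  obtain ⟨N, hN⟩ := hg.2 a b
  exact ⟨M + N, fun t ht => (abs_add_le _ _).trans (add_le_add (hM t ht) (hN t ht))⟩

theorem mul (hf : LocBdd f) (hg : LocBdd g) : LocBdd fun t => f t * g t := by
  refine ⟨hf.1.mul hg.1, fun a b => ?_⟩
  obtain ⟨M, hM⟩ := hf.2 a b
  obtain ⟨N, hN⟩ := hg.2 a b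
  refine ⟨M * N, fun t ht => ?_⟩
  rw [abs_mul]
  exact mul_le_mul (hM t ht) (hN t ht) (abs_nonneg _) ((abs_nonneg _).trans (hM t ht))

theorem const (c : ℝ) : LocBdd fun _ => c := of_continuous continuous_const

theorem const_mul (hf : LocBdd f) (c : ℝ) : LocBdd fun t => c * f t := (const c).mul hf

theorem sub (hf : LocBdd f) (hg : LocBdd g) : LocBdd fun t => f t - g t := by
  simpa [sub_eq_add_neg] using hf.add (hg.const_mul (-1))

theorem sq (hf : LocBdd f) : LocBdd fun t => f t ^ 2 := by
  simpa [pow_two] using hf.mul hf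

theorem sum {ι : Type*} (S : Finset ι) {F : ι → ℝ → ℝ} (hF : ∀ i ∈ S, LocBdd (F i)) :
    LocBdd fun t => ∑ i ∈ S, F i t := by
  classical
  induction S using Finset.induction_on with
  | empty => simpa using const 0
  | insert i S hi ih =>
    simp only [Finset.sum_insert hi]
    exact (hF i (Finset.mem_insert_self i S)).add
      (ih fun j hj => hF j (Finset.mem_insert_of_mem hj))

theorem comp_add (hf : LocBdd f) (c : ℝ) : LocBdd fun t => f (t + c) := by
  refine ⟨hf.1.comp (measurable_id.add_const c), fun a b => ?_⟩
  obtain ⟨M, hM⟩ := hf.2 (a + c) (b + c)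
  exact ⟨M, fun t ht => hM _ ⟨by linarith [ht.1], by linarith [ht.2]⟩⟩

theorem floor {h : ℝ} (hh : 0 < h) (u : ℕ → ℝ) : LocBdd fun t => u ⌊t / h⌋₊ := by
  refine ⟨measurable_from_nat.comp (Nat.measurable_floor.comp (measurable_id.div_const h)),
    fun a b => ⟨∑ k ∈ Finset.range (⌊b / h⌋₊ + 1), |u k|, fun t ht => ?_⟩⟩
  refine Finset.single_le_sum (f := fun k => |u k|) (fun k _ => abs_nonneg _) ?_
  rw [Finset.mem_range, Nat.lt_succ_iff]
  exact Nat.floor_mono (div_le_div_of_nonneg_right ht.2 hh.le)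

theorem intervalIntegrable (hf : LocBdd f) (a b : ℝ) : IntervalIntegrable f volume a b := by
  rw [intervalIntegrable_iff]
  obtain ⟨M, hM⟩ := hf.2 (min a b) (max a b)
  refine Measure.integrableOn_of_bounded (M := M) (by simp) hf.1.aestronglyMeasurable ?_
  rw [ae_restrict_iff' measurableSet_uIoc]
  exact Filter.Eventually.of_forall fun t ht => hM t (Ioc_subset_Icc_self ht)

/-- Integrability on a rectangle, as needed to exchange the integrals in `taylor_error_energy`. -/
theorem integrableOn_convolution (hf : LocBdd f) (hg : LocBdd g) (a b c d : ℝ) :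
    IntegrableOn (Function.uncurry fun t v => f v * g (t + v)) (uIoc a b ×ˢ uIoc c d) := by
  obtain ⟨M, hM⟩ := hf.2 (min c d) (max c d)
  obtain ⟨N, hN⟩ := hg.2 (min a b + min c d) (max a b + max c d)
  refine Measure.integrableOn_of_bounded (M := M * N) ?_ ?_ ?_
  · rw [Measure.volume_eq_prod, Measure.prod_prod]
    simp [uIoc, ENNReal.mul_eq_top]
  · exact ((hf.1.comp measurable_snd).mul
      (hg.1.comp (measurable_fst.add measurable_snd))).aestronglyMeasurable
  · rw [ae_restrict_iff' (measurableSet_uIoc.prod measurableSet_uIoc)]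
    refine Filter.Eventually.of_forall fun p hp => ?_
    have h1 := hM p.2 (Ioc_subset_Icc_self hp.2)
    have h2 := hN (p.1 + p.2) ⟨add_le_add hp.1.1.le hp.2.1.le, add_le_add hp.1.2 hp.2.2⟩
    simp only [Function.uncurry, Real.norm_eq_abs, abs_mul]
    exact mul_le_mul h1 h2 (abs_nonneg _) ((abs_nonneg _).trans h1)

theorem intervalIntegrable_convolution (hf : LocBdd f) (hg : LocBdd g) (a b c d : ℝ) :
    IntervalIntegrable (fun t => ∫ v in c..d, f v * g (t + v)) volume a b := by
  rw [intervalIntegrable_iff]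
  have := hf.integrableOn_convolution hg a b c d
  rw [IntegrableOn, Measure.volume_eq_prod, ← Measure.prod_restrict] at this
  have h2 := this.integral_prod_left
  simp only [intervalIntegral.intervalIntegral_eq_integral_uIoc, Function.uncurry] at h2 ⊢
  exact h2.smul (if c ≤ d then (1 : ℝ) else -1)

theorem intervalIntegrable_convolution_right (hf : LocBdd f) (hg : LocBdd g) (a b c d : ℝ) :
    IntervalIntegrable (fun v => ∫ t in a..b, f v * g (t + v)) volume c d := by
  rw [intervalIntegrable_iff]
  have := hf.integrableOn_convolution hg a b c d
  rw [IntegrableOn, Measure.volume_eq_prod, ← Measure.prod_restrict] at this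
  have h2 := this.integral_prod_right
  simp only [intervalIntegral.intervalIntegral_eq_integral_uIoc, Function.uncurry] at h2 ⊢
  exact h2.smul (if a ≤ b then (1 : ℝ) else -1)

end LocBdd

/-! ### Weighted Cauchy–Schwarz and Wirtinger inequalities. -/

/-- The variance `∫ w (g - J / I)²` about the weighted mean `J / I` is nonnegative. -/
theorem sq_integral_mul_le {w g : ℝ → ℝ} {a b : ℝ} (hab : a ≤ b) (hw : LocBdd w) (hg : LocBdd g)
    (hw0 : ∀ t ∈ Icc a b, 0 ≤ w t) (hpos : 0 < ∫ t in a..b, w t) :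
    (∫ t in a..b, w t * g t) ^ 2 ≤ (∫ t in a..b, w t) * ∫ t in a..b, w t * g t ^ 2 := by
  set I := ∫ t in a..b, w t
  set J := ∫ t in a..b, w t * g t
  have h0 : 0 ≤ ∫ t in a..b, w t * (g t - J / I) ^ 2 :=
    intervalIntegral.integral_nonneg hab fun t ht => mul_nonneg (hw0 t ht) (sq_nonneg _)
  have h1 : ∫ t in a..b, w t * (g t - J / I) ^ 2 =
      (∫ t in a..b, w t * g t ^ 2) - 2 * (J / I) * J + (J / I) ^ 2 * I := by
    rw [← intervalIntegral.integral_const_mul, ← intervalIntegral.integral_const_mul,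
      ← intervalIntegral.integral_sub, ← intervalIntegral.integral_add]
    · exact intervalIntegral.integral_congr fun t _ => by ring
    · exact ((hw.mul hg.sq).sub ((hw.mul hg).const_mul _)).intervalIntegrable _ _
    · exact (hw.const_mul _).intervalIntegrable _ _
    · exact (hw.mul hg.sq).intervalIntegrable _ _
    · exact ((hw.mul hg).const_mul _).intervalIntegrable _ _
  rw [h1] at h0
  have h2 := mul_nonneg hpos.le h0
  have h3 : I * ((∫ t in a..b, w t * g t ^ 2) - 2 * (J / I) * J + (J / I) ^ 2 * I) =
      I * (∫ t in a..b, w t * g t ^ 2) - J ^ 2 := by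
    field_simp
    ring
  linarith

/-- Wirtinger's inequality with a constant that is not sharp. -/
theorem wirtinger_of_lt {f f' : ℝ → ℝ} {a b ω : ℝ} (hab : a ≤ b) (hω0 : 0 ≤ ω)
    (hω : ω * (b - a) < Real.pi / 2) (hf : Continuous f) (hf' : Continuous f')
    (hd : ∀ t ∈ Ioo a b, HasDerivWithinAt f (f' t) (Ioi t) t) (hfa : f a = 0) :
    ω ^ 2 * ∫ t in a..b, f t ^ 2 ≤ ∫ t in a..b, f' t ^ 2 := by
  have hcos : ∀ t ∈ Icc a b, 0 < Real.cos (ω * (b - t)) := fun t ht => by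
    refine Real.cos_pos_of_mem_Ioo ⟨?_, ?_⟩
    · have := mul_nonneg hω0 (sub_nonneg.2 ht.2)
      linarith [Real.pi_pos]
    · exact (mul_le_mul_of_nonneg_left (by linarith [ht.1]) hω0).trans_lt hω
  -- `p` solves the Riccati equation `p' = -(ω² + p²)` with `p(b) = 0`. Hence `f'² - ω² f² = (p f²)'
  -- + (f' - p f)²`, and `p f²` vanishes at both ends. The strict bound on `ω (b - a)` keeps the
  -- tangent finite up to `a`.
  set p : ℝ → ℝ := fun t => ω * Real.tan (ω * (b - t)) with hp
  have hpc : ContinuousOn p (Icc a b) := fun t ht => by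
    have h1 : ContinuousAt (fun t => Real.tan (ω * (b - t))) t :=
      ContinuousAt.comp (f := fun t => ω * (b - t))
        (Real.continuousAt_tan.2 (hcos t ht).ne') (by fun_prop)
    exact (continuousAt_const.mul h1).continuousWithinAt
  have hpd : ∀ t ∈ Icc a b, HasDerivAt p (-(ω ^ 2 + p t ^ 2)) t := fun t ht => by
    have h1 : HasDerivAt (fun t => ω * (b - t)) (-ω) t := by
      simpa using ((hasDerivAt_id t).const_sub b).const_mul ω
    have h2 := ((Real.hasDerivAt_tan (hcos t ht).ne').comp t h1).const_mul ω
    refine h2.congr_deriv ?_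
    simp only [hp]
    rw [← Real.inv_one_add_tan_sq (hcos t ht).ne', one_div, inv_inv]
    ring
  have hFTC : ∫ t in a..b, (-(ω ^ 2 + p t ^ 2) * f t ^ 2 + p t * (2 * f t * f' t)) =
      p b * f b ^ 2 - p a * f a ^ 2 := by
    refine intervalIntegral.integral_eq_sub_of_hasDeriv_right_of_le
      (f := fun t => p t * f t ^ 2) hab
      (hpc.mul (hf.pow 2).continuousOn) (fun t ht => ?_) ?_
    · have h1 := (hpd t (Ioo_subset_Icc_self ht)).hasDerivWithinAt (s := Ioi t)
      have h2 := h1.mul ((hd t ht).pow 2)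
      refine h2.congr_deriv ?_
      simp
    · refine ContinuousOn.intervalIntegrable_of_Icc hab ?_
      have := hf.continuousOn (s := Icc a b)
      have := hf'.continuousOn (s := Icc a b)
      fun_prop
  have hpb : p b = 0 := by simp [hp]
  rw [hpb, hfa] at hFTC
  rw [← intervalIntegral.integral_const_mul]
  have hle : ∫ t in a..b, (ω ^ 2 * f t ^ 2 +
      (-(ω ^ 2 + p t ^ 2) * f t ^ 2 + p t * (2 * f t * f' t))) ≤ ∫ t in a..b, f' t ^ 2 := by
    refine intervalIntegral.integral_mono_on hab ?_ ((hf'.pow 2).intervalIntegrable _ _)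
      fun t _ => by nlinarith [sq_nonneg (f' t - p t * f t)]
    refine ContinuousOn.intervalIntegrable_of_Icc hab ?_
    have := hf.continuousOn (s := Icc a b)
    have := hf'.continuousOn (s := Icc a b)
    fun_prop
  rw [intervalIntegral.integral_add, hFTC] at hle
  · linarith
  · exact (continuous_const.mul (hf.pow 2)).intervalIntegrable _ _
  · refine ContinuousOn.intervalIntegrable_of_Icc hab ?_
    have := hf.continuousOn (s := Icc a b)
    have := hf'.continuousOn (s := Icc a b)
    fun_prop

/-- The sharp constant is reached by letting `ω` increase to `π / (2h)`; at the limit itself the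
tangent may blow up at `a`. -/
theorem wirtinger {f f' : ℝ → ℝ} {a b h : ℝ} (hh : 0 < h) (hab : a ≤ b) (hb : b - a ≤ h)
    (hf : Continuous f) (hf' : Continuous f')
    (hd : ∀ t ∈ Ioo a b, HasDerivWithinAt f (f' t) (Ioi t) t) (hfa : f a = 0) :
    Real.pi ^ 2 / 4 * ∫ t in a..b, f t ^ 2 ≤ h ^ 2 * ∫ t in a..b, f' t ^ 2 := by
  set ω₀ := Real.pi / (2 * h) with hω₀
  have hω₀pos : 0 < ω₀ := by positivity
  have key : ω₀ ^ 2 * (∫ t in a..b, f t ^ 2) ≤ ∫ t in a..b, f' t ^ 2 := by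
    refine le_of_tendsto (f := fun ω => ω ^ 2 * ∫ t in a..b, f t ^ 2) (x := nhdsWithin ω₀ (Iio ω₀))
      ?_ ?_
    · exact (((continuous_pow 2).mul continuous_const).tendsto ω₀).mono_left nhdsWithin_le_nhds
    · filter_upwards [self_mem_nhdsWithin, mem_nhdsWithin_of_mem_nhds (lt_mem_nhds hω₀pos)]
        with ω hω hω0
      refine wirtinger_of_lt hab (le_of_lt hω0) ?_ hf hf' hd hfa
      have h1 : ω₀ * h = Real.pi / 2 := by rw [hω₀]; field_simp
      have h2 : ω * (b - a) ≤ ω * h := mul_le_mul_of_nonneg_left hb (le_of_lt hω0)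
      have h3 : ω * h < ω₀ * h := mul_lt_mul_of_pos_right hω hh
      linarith
  have h1 : Real.pi ^ 2 / 4 = h ^ 2 * ω₀ ^ 2 := by rw [hω₀]; field_simp; norm_num
  rw [h1, mul_assoc]
  exact mul_le_mul_of_nonneg_left key (sq_nonneg h)

/-- On an interval of length at most `h` the weight `e^{2αt}` varies by a factor of at most
`e^{2αh}`, which is the loss in the constant. -/
theorem wirtinger_exp {f f' : ℝ → ℝ} {a b h α : ℝ} (hh : 0 < h) (hα : 0 ≤ α) (hab : a ≤ b)
    (hb : b - a ≤ h) (hf : Continuous f) (hf' : Continuous f')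
    (hd : ∀ t ∈ Ioo a b, HasDerivWithinAt f (f' t) (Ioi t) t) (hfa : f a = 0) :
    Real.pi ^ 2 / 4 * ∫ t in a..b, Real.exp (2 * α * t) * f t ^ 2 ≤
      h ^ 2 * Real.exp (2 * α * h) * ∫ t in a..b, Real.exp (2 * α * t) * f' t ^ 2 := by
  have h1 : ∫ t in a..b, Real.exp (2 * α * t) * f t ^ 2 ≤
      Real.exp (2 * α * b) * ∫ t in a..b, f t ^ 2 := by
    rw [← intervalIntegral.integral_const_mul]
    refine intervalIntegral.integral_mono_on hab
      (Continuous.intervalIntegrable (by fun_prop) _ _)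
      (Continuous.intervalIntegrable (by fun_prop) _ _) fun t ht => ?_
    refine mul_le_mul_of_nonneg_right (Real.exp_le_exp.2 ?_) (sq_nonneg _)
    exact mul_le_mul_of_nonneg_left ht.2 (by linarith)
  have h2 : Real.exp (2 * α * b) * ∫ t in a..b, f' t ^ 2 ≤
      Real.exp (2 * α * h) * ∫ t in a..b, Real.exp (2 * α * t) * f' t ^ 2 := by
    rw [← intervalIntegral.integral_const_mul, ← intervalIntegral.integral_const_mul]
    refine intervalIntegral.integral_mono_on hab
      (Continuous.intervalIntegrable (by fun_prop) _ _)
      (Continuous.intervalIntegrable (by fun_prop) _ _) fun t ht => ?_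
    rw [← mul_assoc, ← Real.exp_add]
    refine mul_le_mul_of_nonneg_right (Real.exp_le_exp.2 ?_) (sq_nonneg _)
    have := mul_le_mul_of_nonneg_left (show b ≤ h + t by linarith [ht.1]) (show 0 ≤ 2 * α by linarith)
    linarith
  have h3 := mul_le_mul_of_nonneg_left (wirtinger hh hab hb hf hf' hd hfa)
    (Real.exp_nonneg (2 * α * b))
  have h4 := mul_le_mul_of_nonneg_left h1 (show 0 ≤ Real.pi ^ 2 / 4 by positivity)
  have h5 := mul_le_mul_of_nonneg_left h2 (sq_nonneg h)
  linarith

/-! ### Energy of the sampling errors. -/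

/-- Adds up the sampling intervals; the free right end `b` takes care of the last, incomplete one.
-/
theorem integral_le_integral_of_steps {F G : ℝ → ℝ} (hF : LocBdd F) (hG : LocBdd G) {h : ℝ}
    (hh : 0 < h) {N : ℕ}
    (hstep : ∀ k : ℕ, N ≤ k → ∀ b ∈ Icc (k * h) ((k + 1) * h),
      ∫ t in (k * h)..b, F t ≤ ∫ t in (k * h)..b, G t) {T : ℝ} (hT : N * h ≤ T) :
    ∫ t in (N * h)..T, F t ≤ ∫ t in (N * h)..T, G t := by
  have claim : ∀ k : ℕ, N ≤ k → ∀ b ∈ Icc (k * h) ((k + 1) * h),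
      ∫ t in (N * h)..b, F t ≤ ∫ t in (N * h)..b, G t := by
    intro k hk
    induction k, hk using Nat.le_induction with
    | base => exact hstep N le_rfl
    | succ k hk ih =>
      intro b hb
      have h1 := ih ((k + 1) * h) ⟨by nlinarith, le_rfl⟩
      have h2 := hstep (k + 1) (by omega) b hb
      push_cast at h2
      rw [← intervalIntegral.integral_add_adjacent_intervals
        (hF.intervalIntegrable _ ((k + 1) * h)) (hF.intervalIntegrable _ _),
        ← intervalIntegral.integral_add_adjacent_intervals
        (hG.intervalIntegrable _ ((k + 1) * h)) (hG.intervalIntegrable _ _)]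
      linarith
  have hT0 : 0 ≤ T / h := div_nonneg ((by positivity : (0 : ℝ) ≤ N * h).trans hT) hh.le
  refine claim ⌊T / h⌋₊ (Nat.le_floor ((le_div_iff₀ hh).2 hT)) T ⟨?_, ?_⟩
  · exact (le_div_iff₀ hh).1 (Nat.floor_le hT0)
  · exact ((div_lt_iff₀ hh).1 (Nat.lt_floor_add_one _)).le

theorem floor_div_eq {h t : ℝ} (hh : 0 < h) {k : ℕ} (ht : t ∈ Ico (k * h) ((k + 1) * h)) :
    ⌊t / h⌋₊ = k := by
  rw [Nat.floor_eq_iff (div_nonneg ((by positivity : (0 : ℝ) ≤ k * h).trans ht.1) hh.le),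
    le_div_iff₀ hh, div_lt_iff₀ hh]
  exact ht

/-- On each sampling interval the error vanishes at the left end, so `wirtinger_exp` applies.
Shifting time by `d` costs `e^{2αd}`, which the factor `e^{-2αd}` absorbs. -/
theorem sampling_error_energy {φ φ' : ℝ → ℝ} {h α d : ℝ} (hh : 0 < h) (hα : 0 ≤ α) (hd : 0 ≤ d)
    (hφ : Continuous φ) (hφ' : Continuous φ')
    (hder : ∀ t, 0 ≤ t → HasDerivWithinAt φ (φ' t) (Ioi t) t) {N : ℕ} (hN : d ≤ N * h)
    {T : ℝ} (hT : N * h ≤ T) :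
    Real.pi ^ 2 / 4 * (Real.exp (-2 * α * d) *
      ∫ t in (N * h)..T, Real.exp (2 * α * t) * (φ (⌊t / h⌋₊ * h - d) - φ (t - d)) ^ 2) ≤
    h ^ 2 * Real.exp (2 * α * h) * ∫ t in (N * h - d)..T, Real.exp (2 * α * t) * φ' t ^ 2 := by
  have hexp : LocBdd fun t => Real.exp (2 * α * t) := LocBdd.of_continuous (by fun_prop)
  have hF : LocBdd fun t => Real.pi ^ 2 / 4 *
      (Real.exp (2 * α * t) * (φ (⌊t / h⌋₊ * h - d) - φ (t - d)) ^ 2) :=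
    (hexp.mul (((LocBdd.floor hh fun k => φ (k * h - d)).sub
      (LocBdd.of_continuous (by fun_prop))).sq)).const_mul _
  have hG : LocBdd fun t => h ^ 2 * Real.exp (2 * α * h) *
      (Real.exp (2 * α * t) * φ' (t - d) ^ 2) := LocBdd.of_continuous (by fun_prop)
  have h1 := integral_le_integral_of_steps hF hG hh (N := N) (fun k hk b hb => ?_) hT
  · rw [intervalIntegral.integral_const_mul, intervalIntegral.integral_const_mul] at h1
    have h2 : ∫ t in (N * h)..T, Real.exp (2 * α * t) * φ' (t - d) ^ 2 =
        Real.exp (2 * α * d) * ∫ t in (N * h - d)..(T - d), Real.exp (2 * α * t) * φ' t ^ 2 := by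
      rw [← intervalIntegral.integral_const_mul, ← intervalIntegral.integral_comp_sub_right]
      refine intervalIntegral.integral_congr fun t _ => ?_
      rw [← mul_assoc, ← Real.exp_add]
      ring_nf
    have h3 : ∫ t in (N * h - d)..(T - d), Real.exp (2 * α * t) * φ' t ^ 2 ≤
        ∫ t in (N * h - d)..T, Real.exp (2 * α * t) * φ' t ^ 2 :=
      intervalIntegral.integral_mono_interval le_rfl (by linarith) (by linarith)
        (Filter.Eventually.of_forall fun t => by positivity)
        (Continuous.intervalIntegrable (by fun_prop) _ _)
    rw [h2] at h1
    have h4 : Real.exp (-2 * α * d) * Real.exp (2 * α * d) = 1 := by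
      rw [← Real.exp_add]; simp
    calc _ = Real.exp (-2 * α * d) * (Real.pi ^ 2 / 4 *
          ∫ t in (N * h)..T, Real.exp (2 * α * t) * (φ (⌊t / h⌋₊ * h - d) - φ (t - d)) ^ 2) := by ring
      _ ≤ _ := mul_le_mul_of_nonneg_left h1 (Real.exp_nonneg _)
      _ = (Real.exp (-2 * α * d) * Real.exp (2 * α * d)) * (h ^ 2 * Real.exp (2 * α * h) *
          ∫ t in (N * h - d)..(T - d), Real.exp (2 * α * t) * φ' t ^ 2) := by ring
      _ ≤ _ := by
        rw [h4, one_mul]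
        exact mul_le_mul_of_nonneg_left h3 (by positivity)
  · have hkN : d ≤ k * h :=
      hN.trans (mul_le_mul_of_nonneg_right (Nat.cast_le.2 hk) hh.le)
    rw [intervalIntegral.integral_const_mul, intervalIntegral.integral_const_mul]
    have h2 := wirtinger_exp (f := fun t => φ (t - d) - φ (k * h - d))
      (f' := fun t => φ' (t - d)) (a := k * h) (b := b) hh hα hb.1
      (by linarith [hb.2]) (by fun_prop) (by fun_prop) (fun t ht => ?_) (by simp)
    · refine le_trans (le_of_eq ?_) h2
      congr 1
      -- The floor is `k` only before `t_{k+1}`; dropping the endpoints avoids its jump.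
      rw [intervalIntegral.integral_of_le hb.1, intervalIntegral.integral_of_le hb.1,
        integral_Ioc_eq_integral_Ioo, integral_Ioc_eq_integral_Ioo]
      refine setIntegral_congr_fun measurableSet_Ioo fun t ht => ?_
      rw [floor_div_eq hh ⟨ht.1.le, ht.2.trans_le hb.2⟩]
      ring
    · have h3 := hder (t - d) (by linarith [ht.1])
      have h4 : HasDerivWithinAt (fun t => t - d) 1 (Ioi t) t :=
        ((hasDerivAt_id t).sub_const d).hasDerivWithinAt
      have h5 := h3.scomp t h4 (fun v hv => sub_lt_sub_right hv d)
      simpa using h5.sub_const (φ (k * h - d))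

/-! ### Energy of the Taylor remainders. -/

/-- The Taylor polynomial is differentiated in its centre `v`, with `a` fixed; the sum telescopes to
its top term. -/
theorem hasDerivWithinAt_taylor {φ : ℕ → ℝ → ℝ} (a : ℝ) {v : ℝ} {S : Set ℝ} (s : ℕ)
    (hd : ∀ j ≤ s, HasDerivWithinAt (φ j) (φ (j + 1) v) S v) :
    HasDerivWithinAt (fun v => ∑ j ∈ Finset.range (s + 1), φ j v * ((a - v) ^ j / j.factorial))
      (φ (s + 1) v * ((a - v) ^ s / s.factorial)) S v := by
  induction s with
  | zero => simpa using hd 0 le_rfl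
  | succ s ih =>
    have h1 : HasDerivWithinAt (fun v => (a - v) ^ (s + 1) / ((s + 1).factorial : ℝ))
        (-((a - v) ^ s / s.factorial)) S v := by
      have h2 := ((((hasDerivAt_id v).const_sub a).pow (s + 1)).div_const
        ((s + 1).factorial : ℝ)).hasDerivWithinAt (s := S)
      refine h2.congr_deriv ?_
      rw [Nat.factorial_succ]
      have : (s.factorial : ℝ) ≠ 0 := by positivity
      push_cast
      simp
      field_simp
    have h2 := (ih fun j hj => hd j (by omega)).add ((hd (s + 1) le_rfl).mul h1)
    simp only [Finset.sum_range_succ _ (s + 1)]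
    refine h2.congr_deriv ?_
    ring

/-- By the integral form of the remainder, `s! |ρ(t)|` is the modulus of an integral of `vˢ
φ^{(s+1)}(t - d + v)` over `[0, d]`. Cauchy–Schwarz with weight `vˢ` and then Fubini each contribute
`∫ vˢ = d^{s+1} / (s+1)`. -/
theorem taylor_error_energy {φ : ℕ → ℝ → ℝ} {s : ℕ} {α d : ℝ} (hα : 0 ≤ α) (hd : 0 < d)
    (hφ : ∀ j ≤ s, Continuous (φ j)) (hg : LocBdd (φ (s + 1)))
    (hder : ∀ j ≤ s, ∀ t, 0 ≤ t → HasDerivWithinAt (φ j) (φ (j + 1) t) (Ioi t) t)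
    {a b : ℝ} (ha : d ≤ a) (hab : a ≤ b) :
    ((s + 1).factorial : ℝ) ^ 2 * (Real.exp (-2 * α * d) / d ^ (s + 1) *
      ∫ t in a..b, Real.exp (2 * α * t) *
        (φ 0 (t - d) - ∑ j ∈ Finset.range (s + 1), φ j t * ((-d) ^ j / j.factorial)) ^ 2) ≤
    d ^ (s + 1) * ∫ t in (a - d)..b, Real.exp (2 * α * t) * φ (s + 1) t ^ 2 := by
  set g := φ (s + 1) with hgdef
  set ρ : ℝ → ℝ := fun t =>
    φ 0 (t - d) - ∑ j ∈ Finset.range (s + 1), φ j t * ((-d) ^ j / j.factorial) with hρ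
  set G : ℝ → ℝ := fun t => Real.exp (2 * α * t) * g t ^ 2 with hG
  have hGb : LocBdd G := (LocBdd.of_continuous (by fun_prop)).mul hg.sq
  have hG0 : ∀ t, 0 ≤ G t := fun t => by positivity
  have hρc : Continuous ρ := by
    refine ((hφ 0 (Nat.zero_le s)).comp (by fun_prop)).sub (continuous_finsetSum _ fun j hj => ?_)
    exact (hφ j (by simpa [Nat.lt_succ_iff] using hj)).mul continuous_const
  have hpow : LocBdd fun v : ℝ => v ^ s := LocBdd.of_continuous (by fun_prop)
  have hIpow : ∫ v in (0 : ℝ)..d, v ^ s = d ^ (s + 1) / (s + 1) := by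
    rw [integral_pow]; simp
  have hrep : ∀ t, d ≤ t → (s.factorial : ℝ) ^ 2 * ρ t ^ 2 =
      (∫ v in (0 : ℝ)..d, v ^ s * g (v + (t - d))) ^ 2 := by
    intro t ht
    -- At `v = t - d` the Taylor polynomial reduces to `φ 0 (t - d)`; at `v = t` it is the expansion
    -- subtracted in `ρ`. The difference is `-ρ t`.
    have h1 : ∫ v in (t - d)..t, g v * ((t - d - v) ^ s / s.factorial) = -ρ t := by
      have h2 := intervalIntegral.integral_eq_sub_of_hasDeriv_right_of_le
        (f := fun v => ∑ j ∈ Finset.range (s + 1), φ j v * ((t - d - v) ^ j / j.factorial))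
        (f' := fun v => g v * ((t - d - v) ^ s / s.factorial)) (a := t - d) (b := t) (by linarith)
        ?_ (fun v hv => hasDerivWithinAt_taylor _ s fun j hj => hder j hj v (by linarith [hv.1]))
        ((hg.mul (LocBdd.of_continuous (by fun_prop))).intervalIntegrable _ _)
      · rw [h2, Finset.sum_range_succ' _ s]
        simp [hρ, Finset.sum_range_succ']
      · refine (continuous_finsetSum _ fun j hj => ?_).continuousOn
        exact (hφ j (by simpa [Nat.lt_succ_iff] using hj)).mul (by fun_prop)
    have h3 : ∫ v in (t - d)..t, g v * ((t - d - v) ^ s / s.factorial) =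
        ((-1) ^ s / s.factorial) * ∫ v in (0 : ℝ)..d, v ^ s * g (v + (t - d)) := by
      rw [← intervalIntegral.integral_const_mul]
      have := intervalIntegral.integral_comp_add_right (a := 0) (b := d)
        (fun v => g v * ((t - d - v) ^ s / s.factorial)) (t - d)
      rw [zero_add, show d + (t - d) = t by ring] at this
      rw [← this]
      refine intervalIntegral.integral_congr fun v _ => ?_
      rw [show t - d - (v + (t - d)) = -1 * v by ring, mul_pow]
      ring
    rw [h3] at h1
    have h4 : ρ t ^ 2 = (((-1) ^ s / s.factorial) *
        ∫ v in (0 : ℝ)..d, v ^ s * g (v + (t - d))) ^ 2 := by rw [h1]; ring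
    have h5 : ((-1 : ℝ) ^ s) ^ 2 = 1 := by rw [← pow_mul, mul_comm, pow_mul]; simp
    have : (s.factorial : ℝ) ≠ 0 := by positivity
    rw [h4, mul_pow, div_pow, h5]
    field_simp
  have hpt : ∀ t ∈ Icc a b, (s.factorial : ℝ) ^ 2 * Real.exp (-2 * α * d) *
      (Real.exp (2 * α * t) * ρ t ^ 2) ≤
      d ^ (s + 1) / (s + 1) * ∫ v in (0 : ℝ)..d, v ^ s * G (t + v - d) := by
    intro t ht
    have htd : d ≤ t := ha.trans ht.1
    have hgt : LocBdd fun v => g (v + (t - d)) := hg.comp_add _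
    have h1 := sq_integral_mul_le hd.le hpow hgt (fun v hv => pow_nonneg hv.1 s)
      (by rw [hIpow]; positivity)
    rw [← hrep t htd, hIpow] at h1
    have h2 : Real.exp (2 * α * (t - d)) * (∫ v in (0 : ℝ)..d, v ^ s * g (v + (t - d)) ^ 2) ≤
        ∫ v in (0 : ℝ)..d, v ^ s * G (t + v - d) := by
      rw [← intervalIntegral.integral_const_mul]
      refine intervalIntegral.integral_mono_on hd.le
        (((hpow.mul hgt.sq).const_mul _).intervalIntegrable _ _)
        ((hpow.mul ((hGb.comp_add (t - d)))).intervalIntegrable _ _ |>.congr ?_) fun v hv => ?_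
      · exact fun v _ => by ring_nf
      · have h3 : Real.exp (2 * α * (t - d)) ≤ Real.exp (2 * α * (t + v - d)) :=
          Real.exp_le_exp.2 (mul_le_mul_of_nonneg_left (by linarith [hv.1]) (by linarith))
        have h4 : 0 ≤ v ^ s * g (v + (t - d)) ^ 2 :=
          mul_nonneg (pow_nonneg hv.1 s) (sq_nonneg _)
        have h5 := mul_le_mul_of_nonneg_right h3 h4
        simp only [hG]
        rw [show t + v - d = v + (t - d) by ring] at h5 ⊢
        linarith
    have h3 : Real.exp (-2 * α * d) * Real.exp (2 * α * t) = Real.exp (2 * α * (t - d)) := by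
      rw [← Real.exp_add]; ring_nf
    calc _ = Real.exp (2 * α * (t - d)) * ((s.factorial : ℝ) ^ 2 * ρ t ^ 2) := by
          rw [← h3]; ring
      _ ≤ Real.exp (2 * α * (t - d)) * (d ^ (s + 1) / (s + 1) *
          ∫ v in (0 : ℝ)..d, v ^ s * g (v + (t - d)) ^ 2) :=
        mul_le_mul_of_nonneg_left h1 (Real.exp_nonneg _)
      _ = d ^ (s + 1) / (s + 1) * (Real.exp (2 * α * (t - d)) *
          ∫ v in (0 : ℝ)..d, v ^ s * g (v + (t - d)) ^ 2) := by ring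
      _ ≤ _ := mul_le_mul_of_nonneg_left h2 (by positivity)
  have hGd : LocBdd fun t => G (t - d) := hGb.comp_add (-d)
  have hint : ∫ t in a..b, (∫ v in (0 : ℝ)..d, v ^ s * G (t + v - d)) ≤
      d ^ (s + 1) / (s + 1) * ∫ t in (a - d)..b, G t := by
    rw [intervalIntegral_intervalIntegral_swap (hpow.integrableOn_convolution hGd a b 0 d),
      ← hIpow, ← intervalIntegral.integral_mul_const]
    refine intervalIntegral.integral_mono_on hd.le ?_ ?_ fun v hv => ?_
    · exact hpow.intervalIntegrable_convolution_right hGd a b 0 d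
    · exact (hpow.mul (LocBdd.const _)).intervalIntegrable _ _
    · rw [intervalIntegral.integral_const_mul]
      refine mul_le_mul_of_nonneg_left ?_ (pow_nonneg hv.1 s)
      have h1 := intervalIntegral.integral_comp_add_right (a := a) (b := b) G (v - d)
      simp only [← add_sub_assoc] at h1
      rw [h1]
      -- For `0 ≤ v ≤ d` the shifted interval `[a + v - d, b + v - d]` lies in `[a - d, b]`.
      exact intervalIntegral.integral_mono_interval (by linarith [hv.1]) (by linarith)
        (by linarith [hv.2]) (Filter.Eventually.of_forall hG0) (hGb.intervalIntegrable _ _)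
  have hfin := intervalIntegral.integral_mono_on hab
    (Continuous.intervalIntegrable (by fun_prop) _ _)
    ((hpow.intervalIntegrable_convolution hGd a b 0 d).const_mul _) hpt
  rw [intervalIntegral.integral_const_mul, intervalIntegral.integral_const_mul] at hfin
  have hfin2 := hfin.trans (mul_le_mul_of_nonneg_left hint (by positivity))
  rw [Nat.factorial_succ]
  push_cast
  have hdp : 0 < d ^ (s + 1) := by positivity
  have hs : (0 : ℝ) < (s : ℝ) + 1 := by positivity
  have hmul := mul_le_mul_of_nonneg_left hfin2
    (show 0 ≤ ((s : ℝ) + 1) ^ 2 / d ^ (s + 1) by positivity)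
  refine le_trans (le_of_eq ?_) (hmul.trans (le_of_eq ?_))
  · ring
  · field_simp

/-! ### Existence of closed-loop solutions. -/

/-- The constant input is adjoined to the state, so that the exponential of the block matrix with
rows `[A, B]` and `[0, 0]` solves the equation. -/
theorem exists_hasDerivAt_linear (A : Matrix (Fin n) (Fin n) ℝ) (B : Matrix (Fin n) (Fin m) ℝ)
    (x₀ : Fin n → ℝ) (u : Fin m → ℝ) :
    ∃ φ : ℝ → Fin n → ℝ, φ 0 = x₀ ∧ ∀ t, HasDerivAt φ (A *ᵥ φ t + B *ᵥ u) t := by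
  set L : ((Fin n → ℝ) × (Fin m → ℝ)) →L[ℝ] ((Fin n → ℝ) × (Fin m → ℝ)) :=
    LinearMap.toContinuousLinearMap
      ((A.mulVecLin.coprod B.mulVecLin).prod 0) with hL
  have hLz : ∀ z, L z = (A *ᵥ z.1 + B *ᵥ z.2, 0) := fun z => by simp [hL]
  set z : ℝ → (Fin n → ℝ) × (Fin m → ℝ) := fun t => NormedSpace.exp (t • L) (x₀, u) with hz
  have hz0 : z 0 = (x₀, u) := by simp [hz]
  have hzd : ∀ t, HasDerivAt z (L (z t)) t := fun t =>
    (hasDerivAt_exp_smul_const' (𝕂 := ℝ) L t).clm_apply (hasDerivAt_const t (x₀, u)) |>.congr_deriv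
      (by simp [hz])
  have h2d : ∀ t, HasDerivAt (fun t => (z t).2) 0 t := fun t => by
    have := (ContinuousLinearMap.snd ℝ (Fin n → ℝ) (Fin m → ℝ)).hasFDerivAt.comp_hasDerivAt t
      (hzd t)
    exact this.congr_deriv (by simp [hLz])
  have h2 : ∀ t, (z t).2 = u := fun t => by
    have := is_const_of_deriv_eq_zero (f := fun t => (z t).2)
      (fun t => (h2d t).differentiableAt) (fun t => (h2d t).deriv) t 0
    simpa [hz0] using this
  refine ⟨fun t => (z t).1, by simp [hz0], fun t => ?_⟩
  have := (ContinuousLinearMap.fst ℝ (Fin n → ℝ) (Fin m → ℝ)).hasFDerivAt.comp_hasDerivAt t (hzd t)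
  simpa [hLz, h2, Function.comp_def] using this

/-- Causality: it lets the control be computed from any stage of the construction that is already
correct up to `t_k`. -/
theorem control_congr (C : Matrix (Fin l) (Fin n) ℝ) (K : Fin (s + 1) → Matrix (Fin m) (Fin l) ℝ)
    (q : Fin s → ℕ) {h : ℝ} (hh : 0 < h) {x x' : ℝ → Fin n → ℝ} {k : ℕ}
    (hx : ∀ t ∈ Icc 0 (k * h), x t = x' t) : control C K q h x k = control C K q h x' k := by
  have ho : ∀ t ≤ k * h, output C x t = output C x' t := fun t ht => by
    unfold output
    split_ifs with h0
    · rfl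
    · rw [hx t ⟨not_lt.1 h0, ht⟩]
  have hq : ∀ i : Fin s, (k : ℝ) * h - q i * h ≤ k * h := fun i => by
    have : 0 ≤ (q i : ℝ) * h := by positivity
    linarith
  simp only [control, ho _ le_rfl, ho _ (hq _)]

/-- The solution of `ẋ = A x + B u`, `x(0) = x₀`, for a constant input `u`. -/
noncomputable def flow (A : Matrix (Fin n) (Fin n) ℝ) (B : Matrix (Fin n) (Fin m) ℝ)
    (x₀ : Fin n → ℝ) (u : Fin m → ℝ) : ℝ → Fin n → ℝ :=
  (exists_hasDerivAt_linear A B x₀ u).choose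

theorem flow_zero (A : Matrix (Fin n) (Fin n) ℝ) (B : Matrix (Fin n) (Fin m) ℝ)
    (x₀ : Fin n → ℝ) (u : Fin m → ℝ) : flow A B x₀ u 0 = x₀ :=
  (exists_hasDerivAt_linear A B x₀ u).choose_spec.1

theorem hasDerivAt_flow (A : Matrix (Fin n) (Fin n) ℝ) (B : Matrix (Fin n) (Fin m) ℝ)
    (x₀ : Fin n → ℝ) (u : Fin m → ℝ) (t : ℝ) :
    HasDerivAt (flow A B x₀ u) (A *ᵥ flow A B x₀ u t + B *ᵥ u) t :=
  (exists_hasDerivAt_linear A B x₀ u).choose_spec.2 t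

section Construction

variable (A : Matrix (Fin n) (Fin n) ℝ) (B : Matrix (Fin n) (Fin m) ℝ)
  (C : Matrix (Fin l) (Fin n) ℝ) (K : Fin (s + 1) → Matrix (Fin m) (Fin l) ℝ) (q : Fin s → ℕ)
  (h : ℝ) (Ω : Matrix (Fin m) (Fin m) ℝ) (σ : ℝ) (x₀ : Fin n → ℝ)

open Classical in
/-- The closed loop run up to the sampling instant `t_k`, with the control value chosen there
held forever. -/
noncomputable def heldLoop : ℕ → (ℝ → Fin n → ℝ) × (Fin m → ℝ)
  | 0 => (flow A B x₀ (control C K q h (fun _ => x₀) 0), control C K q h (fun _ => x₀) 0)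
  | k + 1 =>
    let x := (heldLoop k).1
    let u := control C K q h x (k + 1)
    let û := if Triggered Ω σ u (heldLoop k).2 then u else (heldLoop k).2
    (fun t => if t ≤ ((k + 1 : ℕ) : ℝ) * h then x t else
      flow A B (x (((k + 1 : ℕ) : ℝ) * h)) û (t - ((k + 1 : ℕ) : ℝ) * h), û)

theorem heldLoop_zero :
    (heldLoop A B C K q h Ω σ x₀ 0).1 = flow A B x₀ (heldLoop A B C K q h Ω σ x₀ 0).2 := rfl

theorem heldLoop_succ_of_le {k : ℕ} {t : ℝ} (ht : t ≤ ((k + 1 : ℕ) : ℝ) * h) :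
    (heldLoop A B C K q h Ω σ x₀ (k + 1)).1 t = (heldLoop A B C K q h Ω σ x₀ k).1 t := by
  simp only [heldLoop]
  exact if_pos ht

theorem heldLoop_eq_flow (k : ℕ) {t : ℝ} (ht : k * h ≤ t) :
    (heldLoop A B C K q h Ω σ x₀ k).1 t = flow A B ((heldLoop A B C K q h Ω σ x₀ k).1 (k * h))
      (heldLoop A B C K q h Ω σ x₀ k).2 (t - k * h) := by
  cases k with
  | zero => simp [heldLoop_zero, flow_zero]
  | succ k =>
    rcases ht.eq_or_lt with rfl | ht
    · rw [sub_self, flow_zero]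
    · rw [heldLoop_succ_of_le _ _ _ _ _ _ _ _ _ le_rfl]
      simp only [heldLoop]
      rw [if_neg (not_le.2 ht)]

theorem continuous_heldLoop (k : ℕ) : Continuous (heldLoop A B C K q h Ω σ x₀ k).1 := by
  have hf : ∀ y u, Continuous (flow A B y u) := fun y u =>
    continuous_iff_continuousAt.2 fun t => (hasDerivAt_flow A B y u t).continuousAt
  induction k with
  | zero => exact hf _ _
  | succ k ih =>
    simp only [heldLoop]
    refine Continuous.if_le ih ((hf _ _).comp (by fun_prop)) continuous_id continuous_const ?_
    intro t ht
    rw [show t = ((k + 1 : ℕ) : ℝ) * h from ht, sub_self, flow_zero]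

theorem heldLoop_eq_of_le {h : ℝ} (hh : 0 < h) {k j : ℕ} (hkj : k ≤ j) {t : ℝ}
    (ht : t ≤ ((k + 1 : ℕ) : ℝ) * h) :
    (heldLoop A B C K q h Ω σ x₀ j).1 t = (heldLoop A B C K q h Ω σ x₀ k).1 t := by
  induction j, hkj using Nat.le_induction with
  | base => rfl
  | succ j hkj ih =>
    rw [heldLoop_succ_of_le, ih]
    refine ht.trans (mul_le_mul_of_nonneg_right ?_ hh.le)
    exact_mod_cast Nat.succ_le_succ hkj

/-- The stages of `heldLoop` are glued. Stage `k` is already correct on all of `t < t_{k+1}`, so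
near each time the glued function coincides with a single stage, and continuity and derivatives
carry over. -/
theorem exists_isTrajectory {h : ℝ} (hh : 0 < h) :
    ∃ (x : ℝ → Fin n → ℝ) (û : ℕ → Fin m → ℝ),
      IsTrajectory A B C K q h Ω σ x û ∧ x 0 = x₀ := by
  set S := heldLoop A B C K q h Ω σ x₀ with hS
  set x : ℝ → Fin n → ℝ := fun t => (S ⌊t / h⌋₊).1 t with hx
  have hxk : ∀ (k : ℕ) (t : ℝ), t < ((k + 1 : ℕ) : ℝ) * h → x t = (S k).1 t := by
    intro k t ht
    have hk : ⌊t / h⌋₊ ≤ k := Nat.lt_succ_iff.1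
      ((Nat.floor_lt' (Nat.succ_ne_zero k)).2 ((div_lt_iff₀ hh).2 ht))
    refine (heldLoop_eq_of_le A B C K q Ω σ x₀ hh hk ?_).symm
    push_cast
    exact ((div_lt_iff₀ hh).1 (Nat.lt_floor_add_one _)).le
  have hxk' : ∀ (k : ℕ) (t : ℝ), t ≤ ((k + 1 : ℕ) : ℝ) * h → x t = (S k).1 t := by
    intro k t ht
    rw [hxk (k + 1) t (ht.trans_lt (mul_lt_mul_of_pos_right (by push_cast; linarith) hh))]
    exact heldLoop_succ_of_le A B C K q h Ω σ x₀ ht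
  have hx0 : x 0 = x₀ := by
    rw [hxk 0 0 (by simpa using hh)]
    exact flow_zero _ _ _ _
  refine ⟨x, fun k => (S k).2, ⟨?_, ?_, ?_, ?_, ?_⟩, hx0⟩
  · refine Continuous.continuousOn (continuous_iff_continuousAt.2 fun t => ?_)
    have hev : x =ᶠ[nhds t] (S ⌊t / h⌋₊).1 := by
      have : t < ((⌊t / h⌋₊ + 1 : ℕ) : ℝ) * h := by
        push_cast
        exact (div_lt_iff₀ hh).1 (Nat.lt_floor_add_one _)
      filter_upwards [gt_mem_nhds this] with v hv using hxk _ v hv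
    exact ((continuous_heldLoop A B C K q h Ω σ x₀ _).continuousAt).congr hev.symm
  · intro k t ht
    have ht2 : t < ((k + 1 : ℕ) : ℝ) * h := by push_cast; exact ht.2
    have h1 := (hasDerivAt_flow A B ((S k).1 (k * h)) (S k).2 (t - k * h)).scomp t
      ((hasDerivAt_id t).sub_const ((k : ℝ) * h))
    rw [one_smul, ← heldLoop_eq_flow A B C K q h Ω σ x₀ k ht.1] at h1
    change HasDerivAt _ (A *ᵥ (S k).1 t + _) t at h1
    rw [← hxk k t ht2] at h1
    refine h1.hasDerivWithinAt.congr_of_eventuallyEq_of_mem ?_ ht.1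
    filter_upwards [self_mem_nhdsWithin, mem_nhdsWithin_of_mem_nhds (gt_mem_nhds ht2)] with v hv hv2
    rw [hxk k v hv2]
    exact heldLoop_eq_flow A B C K q h Ω σ x₀ k hv
  · change control C K q h (fun _ => x₀) 0 = _
    refine control_congr C K q hh fun t ht => ?_
    have : t = 0 := le_antisymm (by simpa using ht.2) ht.1
    rw [this, hx0]
  all_goals
    intro k hk
    rw [control_congr C K q hh (x' := (S k).1) (fun t ht => hxk' k t ht.2)] at hk
    simp only [hS, heldLoop]
  · rw [control_congr C K q hh (x' := (S k).1) (fun t ht => hxk' k t ht.2)]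
    exact if_pos hk
  · exact if_neg hk

end Construction

/-! ### A priori bounds up to a fixed sampling instant. -/

theorem exists_norm_mulVec_le {a b : ℕ} (X : Matrix (Fin a) (Fin b) ℝ) :
    ∃ c : ℝ, 0 ≤ c ∧ ∀ v, ‖X *ᵥ v‖ ≤ c * ‖v‖ :=
  ⟨‖LinearMap.toContinuousLinearMap X.mulVecLin‖, norm_nonneg _, fun v =>
    (LinearMap.toContinuousLinearMap X.mulVecLin).le_opNorm v⟩

theorem exists_norm_control_le (C : Matrix (Fin l) (Fin n) ℝ)
    (K : Fin (s + 1) → Matrix (Fin m) (Fin l) ℝ) (q : Fin s → ℕ) {h : ℝ} (hh : 0 < h) :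
    ∃ γ : ℝ, 0 ≤ γ ∧ ∀ (x : ℝ → Fin n → ℝ) (k : ℕ) (M : ℝ), 0 ≤ M →
      (∀ t ∈ Icc 0 (k * h), ‖x t‖ ≤ M) → ‖control C K q h x k‖ ≤ γ * M := by
  obtain ⟨c, hc0, hc⟩ := exists_norm_mulVec_le C
  choose g hg0 hg using fun i => exists_norm_mulVec_le (K i)
  refine ⟨g 0 * c + ∑ i : Fin s, g i.succ * c,
    add_nonneg (mul_nonneg (hg0 _) hc0) (Finset.sum_nonneg fun i _ => mul_nonneg (hg0 _) hc0),
    fun x k M hM hx => ?_⟩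
  have ho : ∀ t ≤ k * h, ‖output C x t‖ ≤ c * M := fun t ht => by
    unfold output
    split_ifs with h0
    · simpa using mul_nonneg hc0 hM
    · exact (hc _).trans (mul_le_mul_of_nonneg_left (hx t ⟨not_lt.1 h0, ht⟩) hc0)
  have hk : ∀ i, ∀ t ≤ k * h, ‖K i *ᵥ output C x t‖ ≤ g i * c * M := fun i t ht =>
    (hg i _).trans ((mul_le_mul_of_nonneg_left (ho t ht) (hg0 i)).trans_eq (mul_assoc _ _ _).symm)
  rw [add_mul, Finset.sum_mul]
  refine (norm_add_le _ _).trans (add_le_add (hk 0 _ le_rfl) ?_)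
  refine (norm_sum_le _ _).trans (Finset.sum_le_sum fun i _ => hk _ _ ?_)
  have : 0 ≤ (q i : ℝ) * h := by positivity
  linarith

/-- Up to a given sampling instant, the state and the control are bounded by a fixed multiple of
the initial state. -/
theorem exists_norm_trajectory_le (A : Matrix (Fin n) (Fin n) ℝ) (B : Matrix (Fin n) (Fin m) ℝ)
    (C : Matrix (Fin l) (Fin n) ℝ) (K : Fin (s + 1) → Matrix (Fin m) (Fin l) ℝ) (q : Fin s → ℕ)
    {h : ℝ} (hh : 0 < h) (Ω : Matrix (Fin m) (Fin m) ℝ) (σ : ℝ) (N : ℕ) :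
    ∃ c : ℝ, 0 ≤ c ∧ ∀ (x : ℝ → Fin n → ℝ) (û : ℕ → Fin m → ℝ),
      IsTrajectory A B C K q h Ω σ x û →
      (∀ t ∈ Icc 0 (N * h), ‖x t‖ ≤ c * ‖x 0‖) ∧ ∀ k ≤ N, ‖û k‖ ≤ c * ‖x 0‖ := by
  obtain ⟨γ, hγ0, hγ⟩ := exists_norm_control_le C K q hh
  obtain ⟨a, ha0, ha⟩ := exists_norm_mulVec_le A
  obtain ⟨b, hb0, hb⟩ := exists_norm_mulVec_le B
  induction N with
  | zero =>
    refine ⟨1 + γ, by linarith, fun x û hx => ?_⟩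
    have hx0 := norm_nonneg (x 0)
    have h1 : ∀ t ∈ Icc 0 (((0 : ℕ) : ℝ) * h), x t = x 0 := fun t ht => by
      rw [le_antisymm (by simpa using ht.2) ht.1]
    refine ⟨fun t ht => ?_, fun k hk => ?_⟩
    · rw [h1 t ht]
      nlinarith
    · rw [Nat.le_zero.1 hk, hx.init]
      have := hγ x 0 ‖x 0‖ hx0 fun t ht => by rw [h1 t ht]
      nlinarith
  | succ N ih =>
    obtain ⟨c, hc0, hc⟩ := ih
    set E := Real.exp ((a + 1) * h) with hE
    have hE1 : 1 ≤ E := Real.one_le_exp (by positivity)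
    set c' := c * E + b * c * E with hc'
    have hcc' : c ≤ c' := by
      have h1 : c * 1 ≤ c * E := mul_le_mul_of_nonneg_left hE1 hc0
      have h2 : 0 ≤ b * c * E := by positivity
      linarith
    have hc'0 : 0 ≤ c' := hc0.trans hcc'
    refine ⟨c' + γ * c', by positivity, fun x û hx => ?_⟩
    obtain ⟨hxN, hûN⟩ := hc x û hx
    have hx0 := norm_nonneg (x 0)
    have hstate : ∀ t ∈ Icc 0 (((N + 1 : ℕ) : ℝ) * h), ‖x t‖ ≤ c' * ‖x 0‖ := by
      intro t ht
      rcases le_total t (N * h) with htN | htN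
      · exact (hxN t ⟨ht.1, htN⟩).trans (mul_le_mul_of_nonneg_right hcc' hx0)
      · have hN0 : 0 ≤ (N : ℝ) * h := by positivity
        have ht2 : t ≤ ((N : ℝ) + 1) * h := by simpa using ht.2
        -- On the new interval `‖x'‖ ≤ a ‖x‖ + b c ‖x 0‖`. The rate `a + 1` in place of `a` is
        -- nonzero, so the closed form of `gronwallBound` applies, and it is at least `1`, so its
        -- inverse can be dropped.
        have hgr := norm_le_gronwallBound_of_norm_deriv_right_le (f := x)
          (f' := fun t => A *ᵥ x t + B *ᵥ û N) (δ := c * ‖x 0‖) (K := a + 1)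
          (ε := b * (c * ‖x 0‖)) (a := N * h) (b := ((N : ℝ) + 1) * h)
          (hx.continuousOn.mono fun v hv => hN0.trans hv.1)
          (fun v hv => (hx.hasDeriv N v hv).mono (Ici_subset_Ici.2 hv.1))
          (hxN _ ⟨hN0, le_rfl⟩)
          (fun v _ => by
            refine (norm_add_le _ _).trans (add_le_add ?_ ?_)
            · refine (ha _).trans ?_
              have := norm_nonneg (x v)
              linarith
            · exact (hb _).trans (mul_le_mul_of_nonneg_left (hûN N le_rfl) hb0))
          t ⟨htN, ht2⟩
        refine hgr.trans ?_
        have hK : a + 1 ≠ 0 := by positivity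
        rw [gronwallBound_of_K_ne_0 hK]
        have he : Real.exp ((a + 1) * (t - N * h)) ≤ E :=
          Real.exp_le_exp.2 (mul_le_mul_of_nonneg_left (by linarith) (by linarith))
        have h1 : b * (c * ‖x 0‖) / (a + 1) ≤ b * (c * ‖x 0‖) :=
          div_le_self (by positivity) (by linarith)
        have h2 : Real.exp ((a + 1) * (t - N * h)) - 1 ≤ E := by linarith
        have h3 : 0 ≤ Real.exp ((a + 1) * (t - N * h)) - 1 :=
          sub_nonneg.2 (Real.one_le_exp (mul_nonneg (by linarith) (by linarith)))
        have h4 := mul_le_mul h1 h2 h3 (by positivity)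
        have h5 := mul_le_mul_of_nonneg_left he (show 0 ≤ c * ‖x 0‖ by positivity)
        rw [hc']
        linarith
    have hle : c' ≤ c' + γ * c' := by
      have := mul_nonneg hγ0 hc'0
      linarith
    refine ⟨fun t ht => (hstate t ht).trans (mul_le_mul_of_nonneg_right hle hx0), fun k hk => ?_⟩
    have hold : ∀ k ≤ N, ‖û k‖ ≤ (c' + γ * c') * ‖x 0‖ := fun k hk =>
      (hûN k hk).trans (mul_le_mul_of_nonneg_right (hcc'.trans hle) hx0)
    rcases Nat.le_succ_iff.1 hk with hk | rfl
    · exact hold k hk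
    · by_cases ht : Triggered Ω σ (control C K q h x (N + 1)) (û N)
      · rw [hx.transmit N ht]
        have := hγ x (N + 1) (c' * ‖x 0‖) (by positivity) hstate
        have h2 : 0 ≤ c' * ‖x 0‖ := by positivity
        linarith
      · rw [hx.hold N ht]
        exact hold N le_rfl

/-! ### From scalar inequalities to quadratic forms. -/

open scoped MatrixOrder in
theorem exists_quadForm_eq_sum_sq {X : Matrix (Fin m) (Fin m) ℝ} (hX : X.PosSemidef) :
    ∃ L : Matrix (Fin m) (Fin m) ℝ, ∀ z, quadForm X z = ∑ j, (L *ᵥ z) j ^ 2 := by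
  obtain ⟨L, rfl⟩ := CStarAlgebra.nonneg_iff_eq_star_mul_self.1 hX.nonneg
  refine ⟨L, fun z => ?_⟩
  rw [quadForm, Matrix.star_eq_conjTranspose, Matrix.conjTranspose_eq_transpose_of_trivial, ← Matrix.mulVec_mulVec,
    dotProduct_transpose_mulVec]
  simp [dotProduct, pow_two]

theorem quadForm_neg {a : Type*} [Fintype a] (X : Matrix a a ℝ) (z : a → ℝ) :
    quadForm X (-z) = quadForm X z := by
  simp [quadForm, Matrix.mulVec_neg]

theorem quadForm_nonneg {X : Matrix (Fin m) (Fin m) ℝ} (hX : X.PosSemidef) (z : Fin m → ℝ) :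
    0 ≤ quadForm X z := by
  simpa [quadForm] using hX.dotProduct_mulVec_nonneg z

theorem exists_quadForm_mulVec_le (X : Matrix (Fin m) (Fin m) ℝ) (Y : Matrix (Fin m) (Fin l) ℝ) :
    ∃ c : ℝ, 0 ≤ c ∧ ∀ z, quadForm X (Y *ᵥ z) ≤ c * ‖z‖ ^ 2 := by
  obtain ⟨a, ha0, ha⟩ := exists_norm_mulVec_le Y
  obtain ⟨b, hb0, hb⟩ := exists_norm_mulVec_le (X * Y)
  refine ⟨m * (a * b), by positivity, fun z => ?_⟩
  rw [quadForm, Matrix.mulVec_mulVec, dotProduct]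
  have : ∀ j ∈ Finset.univ, (Y *ᵥ z) j * ((X * Y) *ᵥ z) j ≤ a * b * ‖z‖ ^ 2 := fun j _ => by
    have h1 := (norm_le_pi_norm (Y *ᵥ z) j).trans (ha z)
    have h2 := (norm_le_pi_norm ((X * Y) *ᵥ z) j).trans (hb z)
    refine (le_abs_self _).trans ?_
    rw [abs_mul]
    refine (mul_le_mul h1 h2 (abs_nonneg _) (by positivity)).trans_eq (by ring)
  refine (Finset.sum_le_card_nsmul _ _ _ this).trans_eq ?_
  simp
  ring

/-- Writing `P = Lᵀ L`, definiteness makes `L` injective, hence invertible, and `‖z‖ ≤ ‖L⁻¹‖ ‖L z‖`.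
-/
theorem exists_le_quadForm {P : Matrix (Fin n) (Fin n) ℝ} (hP : P.PosDef) :
    ∃ c : ℝ, 0 < c ∧ ∀ z, ‖z‖ ^ 2 ≤ c * quadForm P z := by
  obtain ⟨L, hL⟩ := exists_quadForm_eq_sum_sq hP.posSemidef
  have hinj : Function.Injective L.mulVec := by
    rw [← Matrix.coe_mulVecLin, ← LinearMap.ker_eq_bot, LinearMap.ker_eq_bot']
    intro z hz
    by_contra hz0
    have h1 := hP.dotProduct_mulVec_pos hz0
    have h2 := hL z
    rw [Matrix.mulVecLin_apply] at hz
    simp only [hz, quadForm] at h2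
    simp [h2] at h1
  obtain ⟨Y, hY⟩ := (Matrix.mulVec_injective_iff_isUnit.1 hinj).exists_left_inv
  obtain ⟨b, hb0, hb⟩ := exists_norm_mulVec_le Y
  refine ⟨b ^ 2 + 1, by positivity, fun z => ?_⟩
  have h1 : ‖z‖ ≤ b * ‖L *ᵥ z‖ := by
    have := hb (L *ᵥ z)
    rwa [Matrix.mulVec_mulVec, hY, Matrix.one_mulVec] at this
  have h2 : ‖L *ᵥ z‖ ^ 2 ≤ quadForm P z := by
    have h0 : 0 ≤ quadForm P z := quadForm_nonneg hP.posSemidef z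
    rw [← Real.le_sqrt (norm_nonneg _) h0, pi_norm_le_iff_of_nonneg (Real.sqrt_nonneg _)]
    intro j
    refine Real.le_sqrt_of_sq_le ?_
    rw [Real.norm_eq_abs, sq_abs, hL]
    exact Finset.single_le_sum (f := fun j => (L *ᵥ z) j ^ 2) (fun _ _ => sq_nonneg _)
      (Finset.mem_univ j)
  have h3 : ‖z‖ ^ 2 ≤ (b * ‖L *ᵥ z‖) ^ 2 := pow_le_pow_left₀ (norm_nonneg _) h1 2
  have h4 := sq_nonneg ‖L *ᵥ z‖
  have h5 := mul_le_mul_of_nonneg_left h2 (sq_nonneg b)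
  rw [mul_pow] at h3
  linarith

theorem locBdd_dotProduct {y z : ℝ → Fin m → ℝ} (hy : ∀ j, LocBdd fun t => y t j)
    (hz : ∀ j, LocBdd fun t => z t j) : LocBdd fun t => y t ⬝ᵥ z t :=
  LocBdd.sum Finset.univ fun j _ => (hy j).mul (hz j)

theorem locBdd_mulVec (Y : Matrix (Fin l) (Fin m) ℝ) {z : ℝ → Fin m → ℝ}
    (hz : ∀ j, LocBdd fun t => z t j) (j : Fin l) : LocBdd fun t => (Y *ᵥ z t) j :=
  LocBdd.sum Finset.univ fun i _ => (hz i).const_mul (Y j i)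

theorem locBdd_quadForm (X : Matrix (Fin m) (Fin m) ℝ) {z : ℝ → Fin m → ℝ}
    (hz : ∀ j, LocBdd fun t => z t j) : LocBdd fun t => quadForm X (z t) :=
  locBdd_dotProduct hz (locBdd_mulVec X hz)

theorem locBdd_exp (α : ℝ) : LocBdd fun t => Real.exp (2 * α * t) :=
  LocBdd.of_continuous (by fun_prop)

theorem integral_exp_mul_quadForm {X L : Matrix (Fin m) (Fin m) ℝ}
    (hL : ∀ z, quadForm X z = ∑ j, (L *ᵥ z) j ^ 2) (α : ℝ) {z : ℝ → Fin m → ℝ}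
    (hz : ∀ j, LocBdd fun t => z t j) (a b : ℝ) :
    ∫ t in a..b, Real.exp (2 * α * t) * quadForm X (z t) =
      ∑ j, ∫ t in a..b, Real.exp (2 * α * t) * (L *ᵥ z t) j ^ 2 := by
  simp only [hL, Finset.mul_sum]
  exact intervalIntegral.integral_finsetSum fun j _ =>
    ((locBdd_exp α).mul (locBdd_mulVec L hz j).sq).intervalIntegrable _ _

theorem _root_.HasDerivWithinAt.mulVec_apply (Y : Matrix (Fin l) (Fin m) ℝ)
    {ψ : ℝ → Fin m → ℝ} {ψ' : Fin m → ℝ} {S : Set ℝ} {t : ℝ} (h : HasDerivWithinAt ψ ψ' S t) :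
    HasDerivWithinAt (fun t => Y *ᵥ ψ t) (Y *ᵥ ψ') S t :=
  (LinearMap.toContinuousLinearMap Y.mulVecLin).hasFDerivAt.comp_hasDerivWithinAt t h

theorem continuous_mulVec (Y : Matrix (Fin l) (Fin m) ℝ) {ψ : ℝ → Fin m → ℝ} (h : Continuous ψ) :
    Continuous fun t => Y *ᵥ ψ t :=
  (LinearMap.toContinuousLinearMap Y.mulVecLin).continuous.comp h

/-- With `W = Lᵀ L` this is the sum of the scalar inequalities for the coordinates of `L ψ`. -/
theorem sampling_error_quadForm {W : Matrix (Fin m) (Fin m) ℝ} (hW : W.PosSemidef)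
    {ψ ψ' : ℝ → Fin m → ℝ} {h α d : ℝ} (hh : 0 < h) (hα : 0 ≤ α) (hd : 0 ≤ d)
    (hψ : Continuous ψ) (hψ' : Continuous ψ')
    (hder : ∀ t, 0 ≤ t → HasDerivWithinAt ψ (ψ' t) (Ioi t) t) {N : ℕ} (hN : d ≤ N * h)
    {T : ℝ} (hT : N * h ≤ T) :
    Real.pi ^ 2 / 4 * (Real.exp (-2 * α * d) * ∫ t in (N * h)..T,
      Real.exp (2 * α * t) * quadForm W (ψ (⌊t / h⌋₊ * h - d) - ψ (t - d))) ≤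
    h ^ 2 * Real.exp (2 * α * h) * ∫ t in (N * h - d)..T,
      Real.exp (2 * α * t) * quadForm W (ψ' t) := by
  obtain ⟨L, hL⟩ := exists_quadForm_eq_sum_sq hW
  have hc : ∀ j, Continuous fun t => ψ t j := fun j => (continuous_apply j).comp hψ
  rw [integral_exp_mul_quadForm hL α (z := fun t => ψ (⌊t / h⌋₊ * h - d) - ψ (t - d))
    (fun j => (LocBdd.floor hh fun k => ψ (k * h - d) j).sub
      (LocBdd.of_continuous ((hc j).comp (by fun_prop)))),
    integral_exp_mul_quadForm hL α (z := ψ')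
      (fun j => LocBdd.of_continuous ((continuous_apply j).comp hψ')),
    Finset.mul_sum, Finset.mul_sum, Finset.mul_sum]
  refine Finset.sum_le_sum fun j _ => ?_
  simp only [Matrix.mulVec_sub, Pi.sub_apply]
  exact sampling_error_energy (φ := fun t => (L *ᵥ ψ t) j) (φ' := fun t => (L *ᵥ ψ' t) j) hh hα hd
    ((continuous_apply j).comp (continuous_mulVec L hψ))
    ((continuous_apply j).comp (continuous_mulVec L hψ'))
    (fun t ht => hasDerivWithinAt_pi.1 ((hder t ht).mulVec_apply L) j) hN hT

theorem taylor_error_quadForm {R : Matrix (Fin m) (Fin m) ℝ} (hR : R.PosSemidef)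
    {ψ : ℕ → ℝ → Fin m → ℝ} {α d : ℝ} (hα : 0 ≤ α) (hd : 0 < d)
    (hψ : ∀ j ≤ s, Continuous (ψ j)) (hg : ∀ i, LocBdd fun t => ψ (s + 1) t i)
    (hder : ∀ j ≤ s, ∀ t, 0 ≤ t → HasDerivWithinAt (ψ j) (ψ (j + 1) t) (Ioi t) t)
    {a b : ℝ} (ha : d ≤ a) (hab : a ≤ b) :
    ((s + 1).factorial : ℝ) ^ 2 * (Real.exp (-2 * α * d) / d ^ (s + 1) *
      ∫ t in a..b, Real.exp (2 * α * t) * quadForm R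
        (ψ 0 (t - d) - ∑ j ∈ Finset.range (s + 1), ((-d) ^ j / j.factorial : ℝ) • ψ j t)) ≤
    d ^ (s + 1) * ∫ t in (a - d)..b, Real.exp (2 * α * t) * quadForm R (ψ (s + 1) t) := by
  obtain ⟨L, hL⟩ := exists_quadForm_eq_sum_sq hR
  have hc : ∀ j ≤ s, ∀ i, LocBdd fun t => ψ j t i := fun j hj i =>
    LocBdd.of_continuous ((continuous_apply i).comp (hψ j hj))
  rw [integral_exp_mul_quadForm hL α (z := fun t => ψ 0 (t - d) -
      ∑ j ∈ Finset.range (s + 1), ((-d) ^ j / j.factorial : ℝ) • ψ j t) ?_,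
    integral_exp_mul_quadForm hL α hg, Finset.mul_sum, Finset.mul_sum, Finset.mul_sum]
  · refine Finset.sum_le_sum fun i _ => ?_
    have key := taylor_error_energy (φ := fun j t => (L *ᵥ ψ j t) i) hα hd
      (fun j hj => (continuous_apply i).comp (continuous_mulVec L (hψ j hj)))
      (locBdd_mulVec L hg i)
      (fun j hj t ht => hasDerivWithinAt_pi.1 ((hder j hj t ht).mulVec_apply L) i) ha hab
    simpa only [Matrix.mulVec_sub, Pi.sub_apply, Matrix.mulVec_sum, Matrix.mulVec_smul,
      Finset.sum_apply, Pi.smul_apply, smul_eq_mul, mul_comm] using key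
  · intro i
    simp only [Pi.sub_apply, Finset.sum_apply, Pi.smul_apply, smul_eq_mul]
    refine ((hc 0 (Nat.zero_le s) i).comp_add (-d)).sub (LocBdd.sum _ fun j hj => ?_)
    exact (hc j (by simpa [Nat.lt_succ_iff] using hj) i).const_mul _

/-! ### Splitting the control into a state feedback and errors. -/

theorem matF_mulVec (A : Matrix (Fin n) (Fin n) ℝ) (C : Matrix (Fin l) (Fin n) ℝ)
    (K : Fin (s + 1) → Matrix (Fin m) (Fin l) ℝ) (q : Fin s → ℕ) (h : ℝ) (x : Fin n → ℝ) :
    matF A C K q h *ᵥ x = ∑ i, ∑ j ∈ Finset.range (s + 1),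
      ((-(delay q i * h)) ^ j / (j.factorial : ℝ)) • (K i *ᵥ ((C * A ^ j) *ᵥ x)) := by
  have hM : ∀ w : Fin (s + 1) → Fin l → ℝ, matM l q h *ᵥ (fun p => w p.1 p.2) = fun p =>
      (∑ j : Fin (s + 1), ((-(delay q p.1 * h)) ^ (j : ℕ) / ((j : ℕ).factorial : ℝ)) • w j) p.2 := by
    intro w
    ext p
    simp [matM, Matrix.mulVec, dotProduct, Fintype.sum_prod_type]
  have hK : ∀ w : Fin (s + 1) → Fin l → ℝ, matK K *ᵥ (fun p => w p.1 p.2) = ∑ i, K i *ᵥ w i := by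
    intro w
    ext p
    simp [matK, Matrix.mulVec, dotProduct, Fintype.sum_prod_type]
  have hC : matCbar s A C *ᵥ x = fun p => ((C * A ^ (p.1 : ℕ)) *ᵥ x) p.2 := rfl
  rw [matF, ← Matrix.mulVec_mulVec, ← Matrix.mulVec_mulVec, hC,
    hM (fun j => (C * A ^ (j : ℕ)) *ᵥ x),
    hK (fun i => ∑ j : Fin (s + 1), ((-(delay q i * h)) ^ (j : ℕ) / ((j : ℕ).factorial : ℝ)) •
      ((C * A ^ (j : ℕ)) *ᵥ x))]
  refine Finset.sum_congr rfl fun i _ => ?_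
  rw [Matrix.mulVec_sum, Finset.sum_range]
  simp only [Matrix.mulVec_smul]

/-- The state of the closed loop, frozen at `x(0)` for negative times. -/
def stateExt (x : ℝ → Fin n → ℝ) (t : ℝ) : Fin n → ℝ := x (max t 0)

/-- The right-hand side `A x(t) + B û_k`, `t ∈ [t_k, t_{k+1})`, of the closed loop. -/
noncomputable def velocity (A : Matrix (Fin n) (Fin n) ℝ) (B : Matrix (Fin n) (Fin m) ℝ) (h : ℝ)
    (x : ℝ → Fin n → ℝ) (û : ℕ → Fin m → ℝ) (t : ℝ) : Fin n → ℝ :=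
  A *ᵥ stateExt x t + B *ᵥ û ⌊t / h⌋₊

theorem stateExt_of_nonneg {x : ℝ → Fin n → ℝ} {t : ℝ} (ht : 0 ≤ t) : stateExt x t = x t := by
  rw [stateExt, max_eq_left ht]

/-- The sum of the delays serves as a common upper bound for them, which makes `t₀` a sampling
instant after which no negative time is sampled. -/
theorem delay_le_sum (q : Fin s → ℕ) (i : Fin (s + 1)) : delay q i ≤ ∑ j, q j := by
  refine Fin.cases (Nat.zero_le _) (fun j => ?_) i
  exact Finset.single_le_sum (f := q) (fun _ _ => Nat.zero_le _) (Finset.mem_univ j)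

theorem delay_succ (q : Fin s → ℕ) (i : Fin s) : delay q i.succ = q i := rfl

theorem delay_zero (q : Fin s → ℕ) : delay q 0 = 0 := rfl

/-- The error `Kᵢ (y(t_k - qᵢ h) - y(t - qᵢ h))`, `t ∈ [t_k, t_{k+1})`, due to sampling. -/
noncomputable def samplingError (C : Matrix (Fin l) (Fin n) ℝ)
    (K : Fin (s + 1) → Matrix (Fin m) (Fin l) ℝ) (q : Fin s → ℕ) (h : ℝ) (x : ℝ → Fin n → ℝ)
    (i : Fin (s + 1)) (t : ℝ) : Fin m → ℝ :=
  K i *ᵥ (C *ᵥ stateExt x (⌊t / h⌋₊ * h - delay q i * h)) -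
    K i *ᵥ (C *ᵥ stateExt x (t - delay q i * h))

/-- The error of the Taylor approximation of `Kᵢ y(t - qᵢ h)`. -/
noncomputable def taylorError (A : Matrix (Fin n) (Fin n) ℝ) (C : Matrix (Fin l) (Fin n) ℝ)
    (K : Fin (s + 1) → Matrix (Fin m) (Fin l) ℝ) (q : Fin s → ℕ) (h : ℝ) (x : ℝ → Fin n → ℝ)
    (i : Fin s) (t : ℝ) : Fin m → ℝ :=
  K i.succ *ᵥ (C *ᵥ stateExt x (t - q i * h)) - ∑ j ∈ Finset.range (s + 1),
    ((-(q i * h)) ^ j / (j.factorial : ℝ)) • (K i.succ *ᵥ ((C * A ^ j) *ᵥ stateExt x t))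

/-- From `t₀` on, the convention `y = 0` at negative times plays no role, and the sum telescopes. -/
theorem control_eq_sum_errors (A : Matrix (Fin n) (Fin n) ℝ) (C : Matrix (Fin l) (Fin n) ℝ)
    (K : Fin (s + 1) → Matrix (Fin m) (Fin l) ℝ) (q : Fin s → ℕ) {h : ℝ} (hh : 0 < h)
    (x : ℝ → Fin n → ℝ) {t : ℝ} (ht : ((∑ i, q i : ℕ) : ℝ) * h ≤ t) :
    control C K q h x ⌊t / h⌋₊ = matF A C K q h *ᵥ stateExt x t
      + ∑ i, samplingError C K q h x i t + ∑ i, taylorError A C K q h x i t := by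
  have hk : ∑ i, q i ≤ ⌊t / h⌋₊ := Nat.le_floor ((le_div_iff₀ hh).2 ht)
  have ho : ∀ τ, 0 ≤ τ → output C x τ = C *ᵥ stateExt x τ := fun τ hτ => by
    rw [output, if_neg (not_lt.2 hτ), stateExt_of_nonneg hτ]
  have hq : ∀ i, 0 ≤ (⌊t / h⌋₊ : ℝ) * h - q i * h := fun i => by
    have h1 : (q i : ℝ) ≤ ⌊t / h⌋₊ := Nat.cast_le.2 ((delay_le_sum q i.succ).trans hk)
    have := mul_le_mul_of_nonneg_right h1 hh.le
    linarith
  rw [control, ho _ (by positivity), matF_mulVec, Fin.sum_univ_succ, Fin.sum_univ_succ]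
  simp only [ho _ (hq _), samplingError, taylorError, delay_succ, delay_zero,
    Finset.sum_sub_distrib]
  -- For the undelayed term the Taylor polynomial is exact, by `0⁰ = 1`; hence only `s` remainders
  -- occur.
  have h0 : ∑ j ∈ Finset.range (s + 1), ((-(((0 : ℕ) : ℝ) * h)) ^ j / (j.factorial : ℝ)) •
      (K 0 *ᵥ ((C * A ^ j) *ᵥ stateExt x t)) = K 0 *ᵥ (C *ᵥ stateExt x t) := by
    rw [Finset.sum_range_succ']
    simp
  rw [h0]
  simp only [Nat.cast_zero, zero_mul, sub_zero]
  abel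

/-! ### The integrated Lyapunov estimate along a trajectory. -/

section Trajectory

variable {A : Matrix (Fin n) (Fin n) ℝ} {B : Matrix (Fin n) (Fin m) ℝ}
  {C : Matrix (Fin l) (Fin n) ℝ} {K : Fin (s + 1) → Matrix (Fin m) (Fin l) ℝ} {q : Fin s → ℕ}
  {h : ℝ} {Ω : Matrix (Fin m) (Fin m) ℝ} {σ : ℝ} {x : ℝ → Fin n → ℝ} {û : ℕ → Fin m → ℝ}

theorem IsTrajectory.continuous_stateExt (hx : IsTrajectory A B C K q h Ω σ x û) :
    Continuous (stateExt x) :=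
  hx.continuousOn.comp_continuous (by fun_prop) fun t => le_max_right t 0

theorem IsTrajectory.hasDerivWithinAt_stateExt (hx : IsTrajectory A B C K q h Ω σ x û)
    (hh : 0 < h) {t : ℝ} (ht : 0 ≤ t) :
    HasDerivWithinAt (stateExt x) (velocity A B h x û t) (Ioi t) t := by
  have h1 : (⌊t / h⌋₊ : ℝ) * h ≤ t := (le_div_iff₀ hh).1 (Nat.floor_le (div_nonneg ht hh.le))
  have h2 := hx.hasDeriv ⌊t / h⌋₊ t ⟨h1, (div_lt_iff₀ hh).1 (Nat.lt_floor_add_one _)⟩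
  rw [velocity, stateExt_of_nonneg ht]
  exact (h2.mono (Ioi_subset_Ici h1)).congr
    (fun v hv => stateExt_of_nonneg (ht.trans (le_of_lt hv))) (stateExt_of_nonneg ht)

/-- The error is zero after a transmission; otherwise the bound is the negated triggering condition.
-/
theorem IsTrajectory.quadForm_error_le (hx : IsTrajectory A B C K q h Ω σ x û)
    (hΩ : Ω.PosSemidef) (hσ : 0 ≤ σ) (k : ℕ) :
    quadForm Ω (û k - control C K q h x k) ≤ σ * quadForm Ω (control C K q h x k) := by
  have h0 : 0 ≤ σ * quadForm Ω (control C K q h x k) := mul_nonneg hσ (quadForm_nonneg hΩ _)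
  cases k with
  | zero =>
    rw [hx.init, sub_self]
    simpa [quadForm] using h0
  | succ k =>
    by_cases ht : Triggered Ω σ (control C K q h x (k + 1)) (û k)
    · rw [hx.transmit k ht, sub_self]
      simpa [quadForm] using h0
    · rw [hx.hold k ht, ← neg_sub, quadForm_neg]
      exact not_lt.1 ht

theorem IsTrajectory.locBdd_stateExt (hx : IsTrajectory A B C K q h Ω σ x û) (j : Fin n) :
    LocBdd fun t => stateExt x t j :=
  LocBdd.of_continuous ((continuous_apply j).comp hx.continuous_stateExt)

theorem IsTrajectory.locBdd_velocity (hx : IsTrajectory A B C K q h Ω σ x û) (hh : 0 < h)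
    (j : Fin n) : LocBdd fun t => velocity A B h x û t j :=
  (locBdd_mulVec A hx.locBdd_stateExt j).add
    (locBdd_mulVec B (fun i => LocBdd.floor hh fun k => û k i) j)

/-- Since `C B = 0`, the derivative of `y` is `C A x`, which is free of the control and continuous.
-/
theorem IsTrajectory.samplingError_energy (hx : IsTrajectory A B C K q h Ω σ x û) (hh : 0 < h)
    (hCB : C * B = 0) {α : ℝ} (hα : 0 ≤ α) {W : Matrix (Fin m) (Fin m) ℝ} (hW : W.PosSemidef)
    (i : Fin (s + 1)) {T : ℝ} (hT : ((∑ i, q i : ℕ) : ℝ) * h ≤ T) :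
    Real.pi ^ 2 / 4 * (Real.exp (-2 * α * (delay q i * h)) *
      ∫ t in (((∑ i, q i : ℕ) : ℝ) * h)..T,
        Real.exp (2 * α * t) * quadForm W (samplingError C K q h x i t)) ≤
    h ^ 2 * Real.exp (2 * α * h) *
      ∫ t in (((∑ i, q i : ℕ) : ℝ) * h - delay q i * h)..T,
        Real.exp (2 * α * t) * quadForm W (K i *ᵥ (C *ᵥ (A *ᵥ stateExt x t))) := by
  refine sampling_error_quadForm (ψ := fun t => K i *ᵥ (C *ᵥ stateExt x t))
    (ψ' := fun t => K i *ᵥ (C *ᵥ (A *ᵥ stateExt x t))) hW hh hα (by positivity)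
    (continuous_mulVec _ (continuous_mulVec _ hx.continuous_stateExt))
    (continuous_mulVec _ (continuous_mulVec _ (continuous_mulVec _ hx.continuous_stateExt)))
    (fun t ht => ?_)
    (mul_le_mul_of_nonneg_right (Nat.cast_le.2 (delay_le_sum q i)) hh.le) hT
  refine (((hx.hasDerivWithinAt_stateExt hh ht).mulVec_apply C).mulVec_apply (K i)).congr_deriv ?_
  rw [velocity, Matrix.mulVec_add C, Matrix.mulVec_mulVec _ C B, hCB, Matrix.zero_mulVec, add_zero]

/-- Since `C Aʲ B = 0` for `j < s`, the control enters only the derivative of order `s + 1` of the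
output. That one jumps at sampling instants, but it is needed only under the integral. -/
theorem IsTrajectory.taylorError_energy (hx : IsTrajectory A B C K q h Ω σ x û) (hh : 0 < h)
    (hCB : ∀ j < s, C * A ^ j * B = 0) (hq : ∀ i, 0 < q i) {α : ℝ} (hα : 0 ≤ α)
    {R : Matrix (Fin m) (Fin m) ℝ} (hR : R.PosSemidef) (i : Fin s) {T : ℝ}
    (hT : ((∑ i, q i : ℕ) : ℝ) * h ≤ T) :
    ((s + 1).factorial : ℝ) ^ 2 * (Real.exp (-2 * α * (q i * h)) / ((q i : ℝ) * h) ^ (s + 1) *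
      ∫ t in (((∑ i, q i : ℕ) : ℝ) * h)..T,
        Real.exp (2 * α * t) * quadForm R (taylorError A C K q h x i t)) ≤
    ((q i : ℝ) * h) ^ (s + 1) * ∫ t in (((∑ i, q i : ℕ) : ℝ) * h - q i * h)..T,
        Real.exp (2 * α * t) *
          quadForm R (K i.succ *ᵥ ((C * A ^ s) *ᵥ velocity A B h x û t)) := by
  set ψ : ℕ → ℝ → Fin m → ℝ := fun j t => if j ≤ s then
    K i.succ *ᵥ ((C * A ^ j) *ᵥ stateExt x t) else
    K i.succ *ᵥ ((C * A ^ s) *ᵥ velocity A B h x û t) with hψ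
  have hψle : ∀ j ≤ s, ψ j = fun t => K i.succ *ᵥ ((C * A ^ j) *ᵥ stateExt x t) :=
    fun j hj => by simp only [hψ, if_pos hj]
  have hψs : ψ (s + 1) = fun t => K i.succ *ᵥ ((C * A ^ s) *ᵥ velocity A B h x û t) := by
    simp [hψ]
  have key := taylor_error_quadForm (s := s) (ψ := ψ) (d := (q i : ℝ) * h) hR hα
    (mul_pos (Nat.cast_pos.2 (hq i)) hh)
    (fun j hj => by
      rw [hψle j hj]
      exact continuous_mulVec _ (continuous_mulVec _ hx.continuous_stateExt))
    (by
      rw [hψs]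
      exact locBdd_mulVec _ (locBdd_mulVec _ (hx.locBdd_velocity hh)))
    (fun j hj t ht => by
      rw [hψle j hj]
      refine (((hx.hasDerivWithinAt_stateExt hh ht).mulVec_apply _).mulVec_apply _).congr_deriv ?_
      rcases hj.lt_or_eq with hj | rfl
      · rw [hψle (j + 1) hj, velocity, Matrix.mulVec_add (C * A ^ j), Matrix.mulVec_mulVec _ _ B,
          hCB j hj, Matrix.zero_mulVec, add_zero, Matrix.mulVec_mulVec _ _ A, Matrix.mul_assoc C,
          ← pow_succ]
      · rw [hψs])
    (mul_le_mul_of_nonneg_right (Nat.cast_le.2 (delay_le_sum q i.succ)) hh.le) hT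
  rw [hψs] at key
  refine le_of_eq_of_le ?_ key
  congr 2
  refine intervalIntegral.integral_congr fun t _ => ?_
  congr 2
  rw [taylorError, hψle 0 (Nat.zero_le s)]
  congr 1
  · simp
  · refine Finset.sum_congr rfl fun j hj => ?_
    rw [hψle j (by simpa [Nat.lt_succ_iff] using hj)]

theorem integral_eq_integral_add_integral {F : ℝ → ℝ} (hF : LocBdd F) (a b c : ℝ) :
    ∫ t in a..c, F t = (∫ t in a..b, F t) + ∫ t in b..c, F t :=
  (intervalIntegral.integral_add_adjacent_intervals (hF.intervalIntegrable _ _)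
    (hF.intervalIntegrable _ _)).symm

/-- The energy of the closed loop on the time interval `[0, t_N]`, `N = ∑ᵢ qᵢ`, that bounds the
weighted Lyapunov function afterwards. -/
noncomputable def initialEnergy (A : Matrix (Fin n) (Fin n) ℝ) (B : Matrix (Fin n) (Fin m) ℝ)
    (C : Matrix (Fin l) (Fin n) ℝ) (K : Fin (s + 1) → Matrix (Fin m) (Fin l) ℝ) (q : Fin s → ℕ)
    (h α : ℝ) (P : Matrix (Fin n) (Fin n) ℝ) (W : Fin (s + 1) → Matrix (Fin m) (Fin m) ℝ)
    (R : Fin s → Matrix (Fin m) (Fin m) ℝ) (x : ℝ → Fin n → ℝ) (û : ℕ → Fin m → ℝ) : ℝ :=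
  Real.exp (2 * α * (((∑ i, q i : ℕ) : ℝ) * h)) *
      quadForm P (stateExt x (((∑ i, q i : ℕ) : ℝ) * h))
    + ∑ i, h ^ 2 * Real.exp (2 * α * h) *
      (∫ t in (((∑ i, q i : ℕ) : ℝ) * h - delay q i * h)..(((∑ i, q i : ℕ) : ℝ) * h),
        Real.exp (2 * α * t) * quadForm (W i) (K i *ᵥ (C *ᵥ (A *ᵥ stateExt x t))))
    + ∑ i, ((q i : ℝ) * h) ^ (s + 1) *
      ∫ t in (((∑ i, q i : ℕ) : ℝ) * h - q i * h)..(((∑ i, q i : ℕ) : ℝ) * h),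
        Real.exp (2 * α * t) *
          quadForm (R i) (K i.succ *ᵥ ((C * A ^ s) *ᵥ velocity A B h x û t))

/-- The pointwise dissipation inequality alone does not make the Lyapunov function decrease: the
error energies are dominated only after integration from `t₀`. -/
theorem IsTrajectory.lyapunov_le (hx : IsTrajectory A B C K q h Ω σ x û) (hh : 0 < h)
    (hs : 0 < s) (hCB : ∀ j < s, C * A ^ j * B = 0) (hq : ∀ i, 0 < q i) (hσ : 0 ≤ σ)
    {α : ℝ} (hα : 0 ≤ α) {P : Matrix (Fin n) (Fin n) ℝ} (hP : P.PosSemidef) (hΩ : Ω.PosSemidef)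
    {W : Fin (s + 1) → Matrix (Fin m) (Fin m) ℝ} (hW : ∀ i, (W i).PosSemidef)
    {R : Fin s → Matrix (Fin m) (Fin m) ℝ} (hR : ∀ i, (R i).PosSemidef)
    (hLMI : (-(phiE A B C K q h α σ P Ω W R)).PosSemidef)
    {T : ℝ} (hT : ((∑ i, q i : ℕ) : ℝ) * h ≤ T) :
    Real.exp (2 * α * T) * quadForm P (stateExt x T) ≤
      initialEnergy A B C K q h α P W R x û := by
  have hPt : Pᵀ = P := by simpa using hP.isHermitian.eq
  have hRt : ∀ i, (R i)ᵀ = R i := fun i => by simpa using (hR i).isHermitian.eq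
  rw [initialEnergy]
  set t₀ : ℝ := ((∑ i, q i : ℕ) : ℝ) * h with ht₀
  have ht₀0 : 0 ≤ t₀ := by positivity
  set X := stateExt x with hX
  set v := velocity A B h x û with hv
  set a : Fin (s + 1) → ℝ → ℝ := fun i t =>
    Real.exp (2 * α * t) * quadForm (W i) (K i *ᵥ (C *ᵥ (A *ᵥ X t))) with ha
  set b : Fin s → ℝ → ℝ := fun i t =>
    Real.exp (2 * α * t) * quadForm (R i) (K i.succ *ᵥ ((C * A ^ s) *ᵥ v t)) with hb
  set p : Fin (s + 1) → ℝ → ℝ := fun i t =>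
    Real.exp (2 * α * t) * quadForm (W i) (samplingError C K q h x i t) with hp
  set r : Fin s → ℝ → ℝ := fun i t =>
    Real.exp (2 * α * t) * quadForm (R i) (taylorError A C K q h x i t) with hr
  have hXb := hx.locBdd_stateExt
  have hvb := hx.locBdd_velocity hh
  have hab : ∀ i, LocBdd (a i) := fun i => (locBdd_exp α).mul (locBdd_quadForm _
    (locBdd_mulVec _ (locBdd_mulVec _ (locBdd_mulVec _ hXb))))
  have hbb : ∀ i, LocBdd (b i) := fun i => (locBdd_exp α).mul (locBdd_quadForm _
    (locBdd_mulVec _ (locBdd_mulVec _ hvb)))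
  have hpb : ∀ i, LocBdd (p i) := fun i => by
    refine (locBdd_exp α).mul (locBdd_quadForm _ fun j => ?_)
    exact (locBdd_mulVec _ (locBdd_mulVec _ fun j =>
      LocBdd.floor hh fun k => X (k * h - delay q i * h) j) j).sub
      (locBdd_mulVec _ (locBdd_mulVec _ fun j => (hXb j).comp_add (-(delay q i * h))) j)
  have hrb : ∀ i, LocBdd (r i) := fun i => by
    refine (locBdd_exp α).mul (locBdd_quadForm _ fun j => ?_)
    simp only [taylorError, Pi.sub_apply, Finset.sum_apply, Pi.smul_apply, smul_eq_mul]
    exact (locBdd_mulVec _ (locBdd_mulVec _ fun j => (hXb j).comp_add (-(q i * h))) j).sub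
      (LocBdd.sum _ fun k _ => (locBdd_mulVec _ (locBdd_mulVec _ hXb) j).const_mul _)
  set V' : ℝ → ℝ := fun t =>
    Real.exp (2 * α * t) * (2 * (X t ⬝ᵥ (P *ᵥ v t)) + 2 * α * quadForm P (X t)) with hV'
  have hV'b : LocBdd V' := (locBdd_exp α).mul
    (((locBdd_dotProduct hXb (locBdd_mulVec P hvb)).const_mul 2).add
      ((locBdd_quadForm P hXb).const_mul _))
  have hFTC : ∫ t in t₀..T, V' t =
      Real.exp (2 * α * T) * quadForm P (X T) - Real.exp (2 * α * t₀) * quadForm P (X t₀) := by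
    refine intervalIntegral.integral_eq_sub_of_hasDeriv_right_of_le
      (f := fun t => Real.exp (2 * α * t) * quadForm P (X t)) hT ?_ (fun t ht => ?_)
      (hV'b.intervalIntegrable _ _)
    · refine Continuous.continuousOn (Continuous.mul (by fun_prop) ?_)
      exact hx.continuous_stateExt.dotProduct (continuous_mulVec P hx.continuous_stateExt)
    · have hd := hx.hasDerivWithinAt_stateExt hh (ht₀0.trans ht.1.le)
      have hdP := hd.mulVec_apply P
      have h1 : HasDerivWithinAt (fun t => quadForm P (X t))
          (v t ⬝ᵥ (P *ᵥ X t) + X t ⬝ᵥ (P *ᵥ v t)) (Ioi t) t := by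
        rw [dotProduct, dotProduct, ← Finset.sum_add_distrib]
        exact HasDerivWithinAt.fun_sum (u := Finset.univ) (A := fun j t => X t j * (P *ᵥ X t) j)
          fun j _ =>
          (hasDerivWithinAt_pi.1 hd j).mul (hasDerivWithinAt_pi.1 hdP j)
      have h2 : HasDerivWithinAt (fun t => Real.exp (2 * α * t))
          (Real.exp (2 * α * t) * (2 * α)) (Ioi t) t := by
        simpa using (((hasDerivAt_id t).const_mul (2 * α)).exp).hasDerivWithinAt (s := Ioi t)
      refine (h2.mul h1).congr_deriv ?_
      rw [dotProduct_mulVec_symm hPt (v t) (X t)]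
      simp only [hV']
      ring
  have hpt : ∀ t ∈ Icc t₀ T, V' t ≤
      ((∑ i, Real.pi ^ 2 / 4 * (Real.exp (-2 * α * (delay q i * h)) * p i t))
      + ∑ i, ((s + 1).factorial : ℝ) ^ 2 *
          (Real.exp (-2 * α * (q i * h)) / ((q i : ℝ) * h) ^ (s + 1) * r i t))
      - ((∑ i, h ^ 2 * Real.exp (2 * α * h) * a i t)
      + ∑ i, ((q i : ℝ) * h) ^ (s + 1) * b i t) := by
    intro t ht
    set u := control C K q h x ⌊t / h⌋₊ with hu
    have h1 := lmi_dissipation A B C h q K σ α hPt W hRt hLMI (X t)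
      (fun i => samplingError C K q h x i t) (fun i => taylorError A C K q h x i t)
      (û ⌊t / h⌋₊ - u) u (control_eq_sum_errors A C K q hh x ht.1) (v t)
      (by rw [add_sub_cancel, hv, velocity])
    have h2 := hx.quadForm_error_le hΩ hσ ⌊t / h⌋₊
    have h3 : 2 * (X t ⬝ᵥ (P *ᵥ v t)) + 2 * α * quadForm P (X t) ≤
        Real.pi ^ 2 / 4 * (∑ i, Real.exp (-2 * α * (delay q i * h)) *
          quadForm (W i) (samplingError C K q h x i t))
        + ((s + 1).factorial : ℝ) ^ 2 * (∑ i : Fin s,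
          Real.exp (-2 * α * (q i * h)) / ((q i : ℝ) * h) ^ (s + 1) *
            quadForm (R i) (taylorError A C K q h x i t))
        - (h ^ 2 * Real.exp (2 * α * h) * (∑ i, quadForm (W i) (K i *ᵥ (C *ᵥ (A *ᵥ X t))))
        + ∑ i : Fin s, ((q i : ℝ) * h) ^ (s + 1) *
          quadForm (R i) (K i.succ *ᵥ ((C * A ^ s) *ᵥ v t))) := by
      rw [← hu] at h2
      linarith
    refine (mul_le_mul_of_nonneg_left h3 (Real.exp_nonneg (2 * α * t))).trans (le_of_eq ?_)
    simp only [mul_sub, mul_add, Finset.mul_sum, ha, hb, hp, hr]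
    congr 2 <;> exact Finset.sum_congr rfl fun i _ => by ring
  have hs1 : ∀ i, LocBdd fun t =>
      Real.pi ^ 2 / 4 * (Real.exp (-2 * α * (delay q i * h)) * p i t) :=
    fun i => ((hpb i).const_mul _).const_mul _
  have hs2 : ∀ i, LocBdd fun t => ((s + 1).factorial : ℝ) ^ 2 *
      (Real.exp (-2 * α * (q i * h)) / ((q i : ℝ) * h) ^ (s + 1) * r i t) :=
    fun i => ((hrb i).const_mul _).const_mul _
  have hs3 : ∀ i, LocBdd fun t => h ^ 2 * Real.exp (2 * α * h) * a i t :=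
    fun i => (hab i).const_mul _
  have hs4 : ∀ i, LocBdd fun t => ((q i : ℝ) * h) ^ (s + 1) * b i t :=
    fun i => (hbb i).const_mul _
  have hS1 := LocBdd.sum Finset.univ fun i _ => hs1 i
  have hS2 := LocBdd.sum Finset.univ fun i _ => hs2 i
  have hS3 := LocBdd.sum Finset.univ fun i _ => hs3 i
  have hS4 := LocBdd.sum Finset.univ fun i _ => hs4 i
  have hmono := intervalIntegral.integral_mono_on hT (hV'b.intervalIntegrable _ _)
    (((hS1.add hS2).sub (hS3.add hS4)).intervalIntegrable _ _) hpt
  rw [hFTC, intervalIntegral.integral_sub ((hS1.add hS2).intervalIntegrable _ _)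
      ((hS3.add hS4).intervalIntegrable _ _),
    intervalIntegral.integral_add (hS1.intervalIntegrable _ _) (hS2.intervalIntegrable _ _),
    intervalIntegral.integral_add (hS3.intervalIntegrable _ _) (hS4.intervalIntegrable _ _),
    intervalIntegral.integral_finsetSum fun i _ => (hs1 i).intervalIntegrable _ _,
    intervalIntegral.integral_finsetSum fun i _ => (hs2 i).intervalIntegrable _ _,
    intervalIntegral.integral_finsetSum fun i _ => (hs3 i).intervalIntegrable _ _,
    intervalIntegral.integral_finsetSum fun i _ => (hs4 i).intervalIntegrable _ _] at hmono
  simp only [intervalIntegral.integral_const_mul] at hmono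
  -- Here `r ≥ 2` enters, through `C B = 0`.
  have hsum1 := Finset.sum_le_sum fun i (_ : i ∈ Finset.univ) =>
    hx.samplingError_energy hh (by simpa using hCB 0 hs) hα (hW i) i hT
  have hsum2 := Finset.sum_le_sum fun i (_ : i ∈ Finset.univ) =>
    hx.taylorError_energy hh hCB hq hα (hR i) i hT
  -- The part over `[t₀, T]` cancels against the negative terms of `hmono`; the part before `t₀`
  -- belongs to `initialEnergy`.
  have hsplit1 : ∀ i, h ^ 2 * Real.exp (2 * α * h) * ∫ t in (t₀ - delay q i * h)..T, a i t =
      h ^ 2 * Real.exp (2 * α * h) * (∫ t in (t₀ - delay q i * h)..t₀, a i t) +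
      h ^ 2 * Real.exp (2 * α * h) * ∫ t in t₀..T, a i t := fun i => by
    rw [← mul_add, ← integral_eq_integral_add_integral (hab i)]
  have hsplit2 : ∀ i, ((q i : ℝ) * h) ^ (s + 1) * ∫ t in (t₀ - q i * h)..T, b i t =
      ((q i : ℝ) * h) ^ (s + 1) * (∫ t in (t₀ - q i * h)..t₀, b i t) +
      ((q i : ℝ) * h) ^ (s + 1) * ∫ t in t₀..T, b i t := fun i => by
    rw [← mul_add, ← integral_eq_integral_add_integral (hbb i)]
  rw [Finset.sum_congr rfl fun i _ => hsplit1 i, Finset.sum_add_distrib] at hsum1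
  rw [Finset.sum_congr rfl fun i _ => hsplit2 i, Finset.sum_add_distrib] at hsum2
  linarith

end Trajectory

/-! ### The initial energy is quadratic in the initial state. -/

theorem integral_exp_mul_quadForm_le {X : Matrix (Fin m) (Fin m) ℝ} {Y : Matrix (Fin m) (Fin l) ℝ}
    {c : ℝ} (hc0 : 0 ≤ c) (hc : ∀ z, quadForm X (Y *ᵥ z) ≤ c * ‖z‖ ^ 2) {α : ℝ} (hα : 0 ≤ α)
    {z : ℝ → Fin l → ℝ} (hz : ∀ j, LocBdd fun t => z t j) {a b M : ℝ} (ha : 0 ≤ a) (hab : a ≤ b)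
    (hM : ∀ t ∈ Icc 0 b, ‖z t‖ ≤ M) :
    ∫ t in a..b, Real.exp (2 * α * t) * quadForm X (Y *ᵥ z t) ≤
      b * (Real.exp (2 * α * b) * (c * M ^ 2)) := by
  have h1 := intervalIntegral.integral_mono_on hab
    (((locBdd_exp α).mul (locBdd_quadForm X (locBdd_mulVec Y hz))).intervalIntegrable a b)
    (g := fun _ => Real.exp (2 * α * b) * (c * M ^ 2)) intervalIntegrable_const
    fun t ht => by
      have ht0 : t ∈ Icc 0 b := ⟨ha.trans ht.1, ht.2⟩
      have h2 : Real.exp (2 * α * t) ≤ Real.exp (2 * α * b) :=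
        Real.exp_le_exp.2 (mul_le_mul_of_nonneg_left ht.2 (by linarith))
      have h3 : quadForm X (Y *ᵥ z t) ≤ c * M ^ 2 := (hc _).trans
        (mul_le_mul_of_nonneg_left (pow_le_pow_left₀ (norm_nonneg _) (hM t ht0) 2) hc0)
      exact (mul_le_mul_of_nonneg_left h3 (Real.exp_nonneg _)).trans
        (mul_le_mul_of_nonneg_right h2 (by positivity))
  refine h1.trans ?_
  rw [intervalIntegral.integral_const, smul_eq_mul]
  exact mul_le_mul_of_nonneg_right (by linarith) (by positivity)

/-- All times involved lie in `[0, t₀]`, where state and control are `O(‖x 0‖)` by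
`exists_norm_trajectory_le`. -/
theorem exists_initialEnergy_le (A : Matrix (Fin n) (Fin n) ℝ) (B : Matrix (Fin n) (Fin m) ℝ)
    (C : Matrix (Fin l) (Fin n) ℝ) (K : Fin (s + 1) → Matrix (Fin m) (Fin l) ℝ) (q : Fin s → ℕ)
    {h : ℝ} (hh : 0 < h) (Ω : Matrix (Fin m) (Fin m) ℝ) (σ : ℝ) {α : ℝ} (hα : 0 ≤ α)
    (P : Matrix (Fin n) (Fin n) ℝ) (W : Fin (s + 1) → Matrix (Fin m) (Fin m) ℝ)
    (R : Fin s → Matrix (Fin m) (Fin m) ℝ) :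
    ∃ c : ℝ, 0 ≤ c ∧ ∀ (x : ℝ → Fin n → ℝ) (û : ℕ → Fin m → ℝ),
      IsTrajectory A B C K q h Ω σ x û →
      initialEnergy A B C K q h α P W R x û ≤ c * ‖x 0‖ ^ 2 := by
  obtain ⟨c, hc0, hc⟩ := exists_norm_trajectory_le A B C K q hh Ω σ (∑ i, q i)
  obtain ⟨a, ha0, ha⟩ := exists_norm_mulVec_le A
  obtain ⟨b, hb0, hb⟩ := exists_norm_mulVec_le B
  obtain ⟨cP, hcP0, hcP⟩ := exists_quadForm_mulVec_le P (1 : Matrix (Fin n) (Fin n) ℝ)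
  choose cW hcW0 hcW using fun i => exists_quadForm_mulVec_le (W i) (K i * (C * A))
  choose cR hcR0 hcR using fun i => exists_quadForm_mulVec_le (R i) (K i.succ * (C * A ^ s))
  set t₀ : ℝ := ((∑ i, q i : ℕ) : ℝ) * h with ht₀
  have ht₀0 : 0 ≤ t₀ := by positivity
  set E := Real.exp (2 * α * t₀) with hE
  set c₁ := a * c + b * c with hc₁
  refine ⟨E * (cP * c ^ 2)
    + (∑ i, h ^ 2 * Real.exp (2 * α * h) * (t₀ * (E * (cW i * c ^ 2))))
    + ∑ i : Fin s, ((q i : ℝ) * h) ^ (s + 1) * (t₀ * (E * (cR i * c₁ ^ 2))), ?_, fun x û hx => ?_⟩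
  · refine add_nonneg (add_nonneg (by positivity) (Finset.sum_nonneg fun i _ => ?_))
      (Finset.sum_nonneg fun i _ => ?_)
    · have := hcW0 i
      positivity
    · have := hcR0 i
      positivity
  obtain ⟨hxb, hûb⟩ := hc x û hx
  have hX : ∀ t ∈ Icc 0 t₀, ‖stateExt x t‖ ≤ c * ‖x 0‖ := fun t ht => by
    rw [stateExt_of_nonneg ht.1]
    exact hxb t ht
  have hv : ∀ t ∈ Icc 0 t₀, ‖velocity A B h x û t‖ ≤ c₁ * ‖x 0‖ := fun t ht => by
    have hk : ⌊t / h⌋₊ ≤ ∑ i, q i := Nat.floor_le_of_le ((div_le_iff₀ hh).2 ht.2)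
    rw [hc₁, add_mul, mul_assoc, mul_assoc]
    exact (norm_add_le _ _).trans (add_le_add
      ((ha _).trans (mul_le_mul_of_nonneg_left (hX t ht) ha0))
      ((hb _).trans (mul_le_mul_of_nonneg_left (hûb _ hk) hb0)))
  have hdel : ∀ i, 0 ≤ t₀ - delay q i * h ∧ t₀ - delay q i * h ≤ t₀ := fun i => by
    have h1 : (delay q i : ℝ) * h ≤ t₀ :=
      mul_le_mul_of_nonneg_right (Nat.cast_le.2 (delay_le_sum q i)) hh.le
    have h2 : 0 ≤ (delay q i : ℝ) * h := by positivity
    exact ⟨by linarith, by linarith⟩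
  rw [initialEnergy, ← ht₀, ← hE, add_mul, add_mul, Finset.sum_mul, Finset.sum_mul]
  refine add_le_add (add_le_add ?_ (Finset.sum_le_sum fun i _ => ?_))
    (Finset.sum_le_sum fun i _ => ?_)
  · have h1 := hcP (stateExt x t₀)
    rw [Matrix.one_mulVec] at h1
    have h2 := pow_le_pow_left₀ (norm_nonneg _) (hX t₀ ⟨ht₀0, le_rfl⟩) 2
    calc _ ≤ E * (cP * (c * ‖x 0‖) ^ 2) := mul_le_mul_of_nonneg_left
          (h1.trans (mul_le_mul_of_nonneg_left h2 hcP0)) (Real.exp_nonneg _)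
      _ = _ := by ring
  · have h1 := integral_exp_mul_quadForm_le (hcW0 i) (hcW i) hα hx.locBdd_stateExt
      (hdel i).1 (hdel i).2 hX
    simp only [← Matrix.mulVec_mulVec] at h1
    calc _ ≤ _ := mul_le_mul_of_nonneg_left h1 (by positivity)
      _ = _ := by ring
  · have h1 := integral_exp_mul_quadForm_le (hcR0 i) (hcR i) hα (hx.locBdd_velocity hh)
      (hdel i.succ).1 (hdel i.succ).2 hv
    simp only [delay_succ, ← Matrix.mulVec_mulVec _ (K i.succ)] at h1
    calc _ ≤ _ := mul_le_mul_of_nonneg_left h1 (by positivity)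
      _ = _ := by ring

theorem norm_le_euclNorm (v : Fin n → ℝ) : ‖v‖ ≤ euclNorm v :=
  (pi_norm_le_iff_of_nonneg (norm_nonneg _)).2 fun i =>
    PiLp.norm_apply_le (WithLp.toLp 2 v : EuclideanSpace ℝ (Fin n)) i

theorem exists_euclNorm_le (n : ℕ) :
    ∃ c : ℝ, 0 ≤ c ∧ ∀ v : Fin n → ℝ, euclNorm v ≤ c * ‖v‖ :=
  ⟨‖((EuclideanSpace.equiv (Fin n) ℝ).symm : (Fin n → ℝ) →L[ℝ] EuclideanSpace ℝ (Fin n))‖,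
    norm_nonneg _, fun v => ((EuclideanSpace.equiv (Fin n) ℝ).symm :
      (Fin n → ℝ) →L[ℝ] EuclideanSpace ℝ (Fin n)).le_opNorm v⟩

end EventTriggered

/-! ### Exponential stability. -/

open EventTriggered in
theorem theorem2 {n m l s : ℕ} (hr : 2 ≤ s + 1)
    (A : Matrix (Fin n) (Fin n) ℝ) (B : Matrix (Fin n) (Fin m) ℝ) (C : Matrix (Fin l) (Fin n) ℝ)
    (hdeg : EventTriggered.HasRelativeDegree A B C (s + 1))
    (h : ℝ) (hh : 0 < h)
    (q : Fin s → ℕ) (hq_pos : ∀ i, 0 < q i) (hq_mono : StrictMono q)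
    (K : Fin (s + 1) → Matrix (Fin m) (Fin l) ℝ)
    (σ : ℝ) (hσ : σ ∈ Set.Ico (0 : ℝ) 1) (α : ℝ) (hα : 0 < α)
    (P : Matrix (Fin n) (Fin n) ℝ) (hP : P.PosDef)
    (Ω : Matrix (Fin m) (Fin m) ℝ) (hΩ : Ω.PosDef)
    (W : Fin (s + 1) → Matrix (Fin m) (Fin m) ℝ) (hW : ∀ i, (W i).PosDef)
    (R : Fin s → Matrix (Fin m) (Fin m) ℝ) (hR : ∀ i, (R i).PosDef)
    (hLMI : (-(EventTriggered.phiE A B C K q h α σ P Ω W R)).PosSemidef) :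
    EventTriggered.ExponentiallyStabilizes A B C K q h Ω σ α := by
  obtain ⟨c₁, hc₁0, hc₁⟩ := exists_norm_trajectory_le A B C K q hh Ω σ (∑ i, q i)
  obtain ⟨c₂, hc₂0, hc₂⟩ := exists_initialEnergy_le A B C K q hh Ω σ hα.le P W R
  obtain ⟨p, hp0, hp⟩ := exists_le_quadForm hP
  obtain ⟨ν, hν0, hν⟩ := exists_euclNorm_le n
  set t₀ : ℝ := ((∑ i, q i : ℕ) : ℝ) * h with ht₀
  set c₃ := c₁ * Real.exp (α * t₀) with hc₃
  have hc₃0 : 0 ≤ c₃ := by positivity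
  set c₄ := Real.sqrt (p * c₂) with hc₄
  have hc₄0 : 0 ≤ c₄ := Real.sqrt_nonneg _
  -- `c₃` serves times before `t₀`, `c₄` times after it, and `ν` converts the sup norm to the
  -- Euclidean norm. The summand `1` makes the constant positive even if the others vanish.
  refine ⟨ν * (c₃ + c₄) + 1, by positivity, fun x₀ =>
    ⟨exists_isTrajectory A B C K q Ω σ x₀ hh, fun x û hx hx0 t ht => ?_⟩⟩
  have key : ‖x t‖ ≤ (c₃ + c₄) * Real.exp (-α * t) * ‖x 0‖ := by
    rcases le_total t t₀ with htt | htt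
    · have h1 : 1 ≤ Real.exp (α * t₀) * Real.exp (-α * t) := by
        rw [← Real.exp_add]
        have := mul_le_mul_of_nonneg_left htt hα.le
        exact Real.one_le_exp (by linarith)
      have h2 := (hc₁ x û hx).1 t ⟨ht, htt⟩
      have h3 := mul_le_mul_of_nonneg_left h1 (show 0 ≤ c₁ * ‖x 0‖ by positivity)
      have h4 : 0 ≤ c₄ * Real.exp (-α * t) * ‖x 0‖ := by positivity
      rw [hc₃]
      linarith
    · have h1 := (hx.lyapunov_le hh (by omega)
        (fun j hj => hdeg.1 j (by omega)) hq_pos hσ.1 hα.le hP.posSemidef hΩ.posSemidef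
        (fun i => (hW i).posSemidef) (fun i => (hR i).posSemidef) hLMI htt).trans (hc₂ x û hx)
      rw [stateExt_of_nonneg ht] at h1
      -- The Lyapunov function is quadratic with weight `e^{2αt}`, so its square root decays at the
      -- rate `α`.
      have h2 : (Real.exp (α * t) * ‖x t‖) ^ 2 ≤ (c₄ * ‖x 0‖) ^ 2 := by
        have h3 : Real.exp (α * t) ^ 2 = Real.exp (2 * α * t) := by
          rw [← Real.exp_nat_mul]
          push_cast
          ring_nf
        rw [mul_pow, mul_pow, h3, hc₄, Real.sq_sqrt (by positivity)]
        calc _ ≤ Real.exp (2 * α * t) * (p * quadForm P (x t)) :=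
              mul_le_mul_of_nonneg_left (hp _) (Real.exp_nonneg _)
          _ = p * (Real.exp (2 * α * t) * quadForm P (x t)) := by ring
          _ ≤ p * (c₂ * ‖x 0‖ ^ 2) := mul_le_mul_of_nonneg_left h1 hp0.le
          _ = _ := by ring
      have h4 : Real.exp (α * t) * ‖x t‖ ≤ c₄ * ‖x 0‖ :=
        le_of_sq_le_sq h2 (by positivity)
      have h5 : Real.exp (-α * t) * Real.exp (α * t) = 1 := by
        rw [← Real.exp_add]
        simp
      have h6 := mul_le_mul_of_nonneg_left h4 (Real.exp_nonneg (-α * t))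
      rw [← mul_assoc, h5, one_mul] at h6
      have h7 : 0 ≤ c₃ * Real.exp (-α * t) * ‖x 0‖ := by positivity
      linarith
  have h1 := hν (x t)
  have h2 : ‖x 0‖ ≤ euclNorm x₀ := by
    rw [hx0]
    exact norm_le_euclNorm x₀
  have h3 : 0 ≤ euclNorm x₀ := norm_nonneg _
  calc euclNorm (x t) ≤ ν * ((c₃ + c₄) * Real.exp (-α * t) * ‖x 0‖) :=
        h1.trans (mul_le_mul_of_nonneg_left key hν0)
    _ ≤ ν * ((c₃ + c₄) * Real.exp (-α * t) * euclNorm x₀) := by gcongr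
    _ = ν * (c₃ + c₄) * Real.exp (-α * t) * euclNorm x₀ := by ring
    _ ≤ (ν * (c₃ + c₄) + 1) * Real.exp (-α * t) * euclNorm x₀ := by gcongr; linarith
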